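/- For a group $G$ and a normal subgroup $N$, a mixed commutator is an element $[g,w]=gwg^{-1}w^{-1}$ with $g\in G$, $w\in N$; $[G,N]$ is the subgroup generated by the mixed commutators, and for $x\in[G,N]$ let $\mathrm{cl}_{G,N}(x)$ be the least number of mixed commutators whose product is $x$ and $\mathrm{scl}_{G,N}(x)=\lim_{m\to\infty}\mathrm{cl}_{G,N}(x^m)/m$ (the limit exists). Put $\mathrm{scl}_G=\mathrm{scl}_{G,G}$ and $G'=[G,G]$. Since $\mathrm{scl}_G\le\mathrm{scl}_{G,N}$ on $[G,N]$, the two functions are bi-Lipschitz equivalent on $[G,N]$ if and only if there is $C>0$ with $\mathrm{scl}_{G,N}(x)\le C\,\mathrm{scl}_G(x)$ for all $x\in[G,N]$. **Theorem.** Let $\ell\ge 2$ and let $\Sigma_\ell$ be a closed connected oriented surface of genus $\ell$, that is, a space homeomorphic to the $4\ell$-gon with its sides identified according to the boundary word $a_1b_1a_1^{-1}b_1^{-1}\cdots a_\ell b_\ell a_\ell^{-1}b_\ell^{-1}$. Let $G_\ell=\pi_1(\Sigma_\ell)$ (with any base point). Then $\mathrm{scl}_{G_\ell}$ and $\mathrm{scl}_{G_\ell,G_\ell'}$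 are not bi-Lipschitz equivalent on $[G_\ell,G_\ell']$. More precisely, take the image of the vertices of the polygon as base point, let $a_1,b_1,\dots,a_\ell,b_\ell\in G_\ell$ be the standard generators given by the edges, so that $[a_1,b_1]\cdots[a_\ell,b_\ell]=1$, and set $$y_i=(b_ia_i^2)\,b_i^{-1}\,(b_ia_i^2)^{-1},\qquad z_i=(b_ia_i^2)\,a_i^{-\ell}\,(b_ia_i^2)^{-1},\qquad x_n=[y_1^n,z_1]\cdots[y_\ell^n,z_\ell].$$ Then $x_n\in[G_\ell,G_\ell']$ for all $n\ge 0$, $\sup_n\mathrm{scl}_{G_\ell}(x_n)<\infty$, and $\lim_{n\to\infty}\mathrm{scl}_{G_\ell,G_\ell'}(x_n)=\infty$. -/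

import Mathlib

namespace SurfaceScl

noncomputable section

open Filter Topology
open scoped commutatorElement

/-! ### Mixed commutators, (stable) mixed commutator length -/

/-- `x` is a mixed commutator `⁅g, w⁆ = g * w * g⁻¹ * w⁻¹` with `g ∈ G` and `w ∈ N`. -/
def IsMixedCommutator {G : Type*} [Group G] (N : Subgroup G) (x : G) : Prop :=
  ∃ g : G, ∃ w ∈ N, x = ⁅g, w⁆

/-- The mixed commutator length `cl_{G,N}(x)`: the least number of mixed commutators whose product
is `x`. It is meaningful for `x` in the mixed commutator subgroup `⁅⊤, N⁆ = [G, N]`, where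
such an expression exists (`exists_mixedCommutator_factorization`). -/
def mixedCl {G : Type*} [Group G] (N : Subgroup G) (x : G) : ℕ :=
  sInf {k : ℕ | ∃ L : List G, L.length = k ∧ (∀ c ∈ L, IsMixedCommutator N c) ∧ L.prod = x}

/-- The stable mixed commutator length `scl_{G,N}(x) = lim_m cl_{G,N}(x ^ m) / m`
for `x ∈ [G, N]`; the limit exists by `tendsto_mixedScl`. -/
def mixedScl {G : Type*} [Group G] (N : Subgroup G) (x : G) : ℝ :=
  limUnder atTop fun m : ℕ => (mixedCl N (x ^ m) : ℝ) / m

/-- The stable commutator length `scl_G = scl_{G,G}` for `x` in the commutator subgroup `[G, G]`. -/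
abbrev scl {G : Type*} [Group G] (x : G) : ℝ := mixedScl (⊤ : Subgroup G) x

/-- `scl_G` and `scl_{G,N}` are (bi-Lipschitzly) equivalent on `[G, N]`. Only this inequality is
required, since `scl_G ≤ scl_{G,N}` always holds on `[G, N]`. -/
def SclEquivalent {G : Type*} [Group G] (N : Subgroup G) : Prop :=
  ∃ C : ℝ, 0 < C ∧ ∀ x ∈ ⁅(⊤ : Subgroup G), N⁆, mixedScl N x ≤ C * scl x

theorem IsMixedCommutator.inv {G : Type*} [Group G] {N : Subgroup G} {x : G}
    (hx : IsMixedCommutator N x) : IsMixedCommutator N x⁻¹ := by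
  obtain ⟨g, w, hw, rfl⟩ := hx
  refine ⟨w * g * w⁻¹, w⁻¹, N.inv_mem hw, ?_⟩
  simp only [commutatorElement_def]
  group

theorem exists_mixedCommutator_factorization {G : Type*} [Group G] {N : Subgroup G} {x : G}
    (hx : x ∈ ⁅(⊤ : Subgroup G), N⁆) :
    ∃ L : List G, (∀ c ∈ L, IsMixedCommutator N c) ∧ L.prod = x := by
  rw [Subgroup.commutator_def] at hx
  induction hx using Subgroup.closure_induction with
  | mem y hy =>
    obtain ⟨g, -, w, hw, rfl⟩ := hy
    exact ⟨[⁅g, w⁆], by simpa using ⟨g, w, hw, rfl⟩, by simp⟩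
  | one => exact ⟨[], by simp, rfl⟩
  | mul y z _ _ hy hz =>
    obtain ⟨L, hL, rfl⟩ := hy
    obtain ⟨M, hM, rfl⟩ := hz
    refine ⟨L ++ M, fun c hc => ?_, by simp⟩
    rcases List.mem_append.1 hc with h | h
    exacts [hL c h, hM c h]
  | inv y _ hy =>
    obtain ⟨L, hL, rfl⟩ := hy
    refine ⟨(L.map fun c => c⁻¹).reverse, fun c hc => ?_, (List.prod_inv_reverse L).symm⟩
    obtain ⟨d, hd, rfl⟩ := List.mem_map.1 (List.mem_reverse.1 hc)
    exact (hL d hd).inv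

theorem mixedCl_mul_le {G : Type*} [Group G] {N : Subgroup G} {x y : G}
    (hx : x ∈ ⁅(⊤ : Subgroup G), N⁆) (hy : y ∈ ⁅(⊤ : Subgroup G), N⁆) :
    mixedCl N (x * y) ≤ mixedCl N x + mixedCl N y := by
  have key : ∀ {z : G}, z ∈ ⁅(⊤ : Subgroup G), N⁆ →
      ∃ L : List G, L.length = mixedCl N z ∧ (∀ c ∈ L, IsMixedCommutator N c) ∧ L.prod = z := by
    intro z hz
    obtain ⟨L, hL, hp⟩ := exists_mixedCommutator_factorization hz
    exact Nat.sInf_mem (s := {k : ℕ | ∃ L : List G, L.length = k ∧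
      (∀ c ∈ L, IsMixedCommutator N c) ∧ L.prod = z}) ⟨L.length, L, rfl, hL, hp⟩
  obtain ⟨L, hl, hL, hp⟩ := key hx
  obtain ⟨M, hm, hM, hq⟩ := key hy
  refine Nat.sInf_le ⟨L ++ M, by simp [hl, hm], ?_, by simp [hp, hq]⟩
  intro c hc
  rcases List.mem_append.1 hc with h | h
  exacts [hL c h, hM c h]

/-- Fekete's lemma: the limit defining `scl_{G,N}` exists on `[G, N]`. -/
theorem tendsto_mixedScl {G : Type*} [Group G] {N : Subgroup G} {x : G}
    (hx : x ∈ ⁅(⊤ : Subgroup G), N⁆) :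
    Tendsto (fun m : ℕ => (mixedCl N (x ^ m) : ℝ) / m) atTop (𝓝 (mixedScl N x)) := by
  have hsub : Subadditive fun m : ℕ => (mixedCl N (x ^ m) : ℝ) := by
    intro m n
    simp only [pow_add]
    exact_mod_cast mixedCl_mul_le (pow_mem hx m) (pow_mem hx n)
  exact tendsto_nhds_limUnder ⟨_, hsub.tendsto_lim ⟨0, by rintro _ ⟨m, rfl⟩; positivity⟩⟩

/-! ### The closed oriented surface of genus `ℓ` -/

/-- The closed unit disc, regarded as a polygon with `4 * ℓ` boundary edges. -/
abbrev Disc : Type := Metric.closedBall (0 : ℂ) 1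

/-- The point at parameter `t ∈ [0, 1]` on the `k`-th of the `4 * ℓ` boundary arcs of the disc,
i.e. the point `exp (2πi (k + t) / 4ℓ)`; arcs are traversed counterclockwise. -/
def arc (ℓ k : ℕ) (t : ℝ) : Disc :=
  ⟨Complex.exp (((2 * Real.pi * ((k + t) / (4 * ℓ)) : ℝ) : ℂ) * Complex.I), by
    rw [mem_closedBall_zero_iff, Complex.norm_exp_ofReal_mul_I]⟩

/-- The side pairing of the `4ℓ`-gon whose boundary word, read counterclockwise, is
`a₁ b₁ a₁⁻¹ b₁⁻¹ ⋯ a_ℓ b_ℓ a_ℓ⁻¹ b_ℓ⁻¹`. -/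
inductive SidePairing (ℓ : ℕ) : Disc → Disc → Prop
  | a (i : Fin ℓ) (t : unitInterval) :
      SidePairing ℓ (arc ℓ (4 * i) t) (arc ℓ (4 * i + 2) (1 - t))
  | b (i : Fin ℓ) (t : unitInterval) :
      SidePairing ℓ (arc ℓ (4 * i + 1) t) (arc ℓ (4 * i + 3) (1 - t))

/-- The standard closed oriented surface `Σ_ℓ` of genus `ℓ ≥ 1`: the `4ℓ`-gon with its sides
identified by the side pairing, with the quotient topology. -/
def Surface (ℓ : ℕ) : Type := Quot (SidePairing ℓ)

instance (ℓ : ℕ) : TopologicalSpace (Surface ℓ) :=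
  inferInstanceAs (TopologicalSpace (Quot (SidePairing ℓ)))

/-- The projection from the disc to the surface. -/
def toSurface (ℓ : ℕ) (z : Disc) : Surface ℓ := Quot.mk _ z

theorem continuous_toSurface (ℓ : ℕ) : Continuous (toSurface ℓ) := continuous_quot_mk

theorem continuous_arc (ℓ k : ℕ) : Continuous (arc ℓ k) := by
  unfold arc
  fun_prop

theorem arc_one (ℓ k : ℕ) : arc ℓ k 1 = arc ℓ (k + 1) 0 := by
  simp [arc]

/-- The base point: the common image of all vertices of the polygon. -/
def vertex (ℓ : ℕ) : Surface ℓ := toSurface ℓ (arc ℓ 0 0)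

theorem toSurface_a (ℓ : ℕ) (i : Fin ℓ) (t : unitInterval) :
    toSurface ℓ (arc ℓ (4 * i) t) = toSurface ℓ (arc ℓ (4 * i + 2) (1 - t)) :=
  Quot.sound (SidePairing.a i t)

theorem toSurface_b (ℓ : ℕ) (i : Fin ℓ) (t : unitInterval) :
    toSurface ℓ (arc ℓ (4 * i + 1) t) = toSurface ℓ (arc ℓ (4 * i + 3) (1 - t)) :=
  Quot.sound (SidePairing.b i t)

theorem toSurface_corners (ℓ : ℕ) (i : Fin ℓ) :
    toSurface ℓ (arc ℓ (4 * i + 3) 0) = toSurface ℓ (arc ℓ (4 * i) 0) ∧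
    toSurface ℓ (arc ℓ (4 * i + 2) 0) = toSurface ℓ (arc ℓ (4 * i) 0) ∧
    toSurface ℓ (arc ℓ (4 * i + 1) 0) = toSurface ℓ (arc ℓ (4 * i) 0) ∧
    toSurface ℓ (arc ℓ (4 * (i + 1)) 0) = toSurface ℓ (arc ℓ (4 * i) 0) := by
  have a0 := toSurface_a ℓ i 0
  have a1 := toSurface_a ℓ i 1
  have b0 := toSurface_b ℓ i 0
  have b1 := toSurface_b ℓ i 1
  simp only [Set.Icc.coe_zero, Set.Icc.coe_one, sub_zero, sub_self, arc_one, add_assoc,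
    Nat.reduceAdd] at a0 a1 b0 b1
  rw [mul_add, mul_one]
  exact ⟨a0.symm, by rw [b1, a0], by rw [a1, b1, a0], by rw [← b0, a1, b1, a0]⟩

theorem toSurface_arc_zero (ℓ : ℕ) (i : ℕ) (hi : i ≤ ℓ) :
    toSurface ℓ (arc ℓ (4 * i) 0) = vertex ℓ := by
  induction i with
  | zero => rfl
  | succ j ih =>
    rw [← ih (by omega)]
    exact (toSurface_corners ℓ ⟨j, hi⟩).2.2.2

/-- The loop in the surface given by the edge `aᵢ` of the polygon. -/
def edgeA (ℓ : ℕ) (i : Fin ℓ) : Path (vertex ℓ) (vertex ℓ) where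
  toFun t := toSurface ℓ (arc ℓ (4 * i) t)
  continuous_toFun := (continuous_toSurface ℓ).comp
    ((continuous_arc ℓ _).comp continuous_subtype_val)
  source' := by simpa using toSurface_arc_zero ℓ i i.2.le
  target' := by
    simp only [Set.Icc.coe_one, arc_one]
    rw [(toSurface_corners ℓ i).2.2.1, toSurface_arc_zero ℓ i i.2.le]

/-- The loop in the surface given by the edge `bᵢ` of the polygon. -/
def edgeB (ℓ : ℕ) (i : Fin ℓ) : Path (vertex ℓ) (vertex ℓ) where
  toFun t := toSurface ℓ (arc ℓ (4 * i + 1) t)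
  continuous_toFun := (continuous_toSurface ℓ).comp
    ((continuous_arc ℓ _).comp continuous_subtype_val)
  source' := by
    simp only [Set.Icc.coe_zero]
    rw [(toSurface_corners ℓ i).2.2.1, toSurface_arc_zero ℓ i i.2.le]
  target' := by
    simp only [Set.Icc.coe_one, arc_one, add_assoc, Nat.reduceAdd]
    rw [(toSurface_corners ℓ i).2.1, toSurface_arc_zero ℓ i i.2.le]

/-- The standard generator `aᵢ` of `π₁(Σ_ℓ)`. In Mathlib's fundamental group `p * q` is the loop
`q` followed by `p`, which is opposite to the usual convention; inversion identifies the two groups,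
so the generator is the inverse of the edge loop. With this choice the relation
`⁅a₁, b₁⁆ * ⋯ * ⁅a_ℓ, b_ℓ⁆ = 1` holds in the written order. -/
def genA (ℓ : ℕ) (i : Fin ℓ) : FundamentalGroup (Surface ℓ) (vertex ℓ) :=
  (FundamentalGroup.fromPath (Path.Homotopic.Quotient.mk (edgeA ℓ i)))⁻¹

/-- The standard generator `bᵢ` of `π₁(Σ_ℓ)`; see `genA` for the convention. -/
def genB (ℓ : ℕ) (i : Fin ℓ) : FundamentalGroup (Surface ℓ) (vertex ℓ) :=
  (FundamentalGroup.fromPath (Path.Homotopic.Quotient.mk (edgeB ℓ i)))⁻¹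

/-! ### The witnessing sequence -/

/-- `y = (b a²) b⁻¹ (b a²)⁻¹`. -/
def elemY {G : Type*} [Group G] (a b : G) : G :=
  (b * a ^ 2) * b⁻¹ * (b * a ^ 2)⁻¹

/-- `z = (b a²) a^{-ℓ} (b a²)⁻¹`. -/
def elemZ {G : Type*} [Group G] (ℓ : ℕ) (a b : G) : G :=
  (b * a ^ 2) * (a ^ ℓ)⁻¹ * (b * a ^ 2)⁻¹

/-- `x_n = ⁅y₁ ^ n, z₁⁆ * ⋯ * ⁅y_ℓ ^ n, z_ℓ⁆`, where `yᵢ` and `zᵢ` are built from `aᵢ` and `bᵢ`. -/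
def witness {G : Type*} [Group G] {ℓ : ℕ} (a b : Fin ℓ → G) (n : ℕ) : G :=
  (List.ofFn fun i : Fin ℓ => ⁅elemY (a i) (b i) ^ n, elemZ ℓ (a i) (b i)⁆).prod

/-- The `n`-th witness in `π₁(X, e(v))`, for a homeomorphism `e` from the standard surface to `X`;
the generators are the images under `e` of the standard generators of `π₁(Σ_ℓ, v)`. -/
def surfaceWitness {ℓ : ℕ} {X : Type*} [TopologicalSpace X] (e : Surface ℓ ≃ₜ X) (n : ℕ) :
    FundamentalGroup X (e (vertex ℓ)) :=
  witness (fun i => FundamentalGroup.map (e : C(Surface ℓ, X)) (vertex ℓ) (genA ℓ i))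
    (fun i => FundamentalGroup.map (e : C(Surface ℓ, X)) (vertex ℓ) (genB ℓ i)) n

end

end SurfaceScl

namespace SurfaceScl

noncomputable section

open Filter Topology
open scoped commutatorElement

/-! ### Estimates for mixed commutator length -/

section MixedCl

variable {G : Type*} [Group G] {N : Subgroup G}

/-! Each x_n is a product of ℓ commutators, so scl_G(x_n) ≤ ℓ. Modulo [G,G'] commutators are central
and bimultiplicative, so [y_i^n, z_i] becomes [a_i,b_i]^(-nℓ); the exponent does not depend on i,
and the surface relation kills the product (`witness_mem`).

The lower bound uses translation numbers. Take lifts to the line of circle homeomorphisms, one for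
each generator, whose product of commutators is a nonzero integer translation c⁻¹ (an action of
nonzero Euler number). They violate the surface relation by the central element c. The
Heisenberg-like group `Twisted` absorbs this defect: a commutator there is [base, base'] times c to
the determinant of the integer coordinates, and giving a_1, b_1 the coordinates (1,0), (0,1)
restores the relation. This yields φ : G → `Twisted`. Elements of G' have zero integer coordinates,
so φ sends a mixed commutator to a genuine commutator of line homeomorphisms, whose translation
number is at most 4 in absolute value. The translation number is a homogeneous quasimorphism, so it
bounds scl_{G,G'} from below (`abs_rot_le_mixedScl`). For x_n the first determinant is -nℓ, so the
translation number is -nℓ·rot(c) + O(1).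

Two inputs remain. Lifts with nonzero Euler number come from two hyperbolic Möbius maps with
perpendicular axes whose commutator is elliptic of order 2; using this pair on two handles gives a
translation, which is where ℓ ≥ 2 enters. Homomorphisms from the surface group to a group Q are
obtained as monodromy of the covering glued from copies of the polygon indexed by Q. -/

theorem mixedCl_le_of_list {x : G} (L : List G) (hL : ∀ c ∈ L, IsMixedCommutator N c)
    (hx : L.prod = x) : mixedCl N x ≤ L.length :=
  Nat.sInf_le ⟨L, rfl, hL, hx⟩

theorem exists_list_length_eq_mixedCl {x : G} (hx : x ∈ ⁅(⊤ : Subgroup G), N⁆) :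
    ∃ L : List G, L.length = mixedCl N x ∧ (∀ c ∈ L, IsMixedCommutator N c) ∧ L.prod = x := by
  obtain ⟨L, hL, hp⟩ := exists_mixedCommutator_factorization hx
  exact Nat.sInf_mem (s := {k : ℕ | ∃ L : List G, L.length = k ∧
    (∀ c ∈ L, IsMixedCommutator N c) ∧ L.prod = x}) ⟨L.length, L, rfl, hL, hp⟩

theorem IsMixedCommutator.mem {x : G} (hx : IsMixedCommutator N x) :
    x ∈ ⁅(⊤ : Subgroup G), N⁆ := by
  obtain ⟨g, w, hw, rfl⟩ := hx
  exact Subgroup.commutator_mem_commutator (Subgroup.mem_top g) hw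

theorem mixedCl_pow_le {x : G} (hx : x ∈ ⁅(⊤ : Subgroup G), N⁆) (m : ℕ) :
    mixedCl N (x ^ m) ≤ m * mixedCl N x := by
  induction m with
  | zero => simpa using mixedCl_le_of_list (N := N) (x := 1) [] (by simp) (by simp)
  | succ m ih =>
    rw [pow_succ, add_mul, one_mul]
    exact (mixedCl_mul_le (pow_mem hx m) hx).trans (by gcongr)

theorem mixedScl_le_mixedCl {x : G} (hx : x ∈ ⁅(⊤ : Subgroup G), N⁆) :
    mixedScl N x ≤ mixedCl N x := by
  refine le_of_tendsto (tendsto_mixedScl hx) ?_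
  filter_upwards [eventually_gt_atTop 0] with m hm
  rw [div_le_iff₀ (by exact_mod_cast hm), mul_comm]
  exact_mod_cast mixedCl_pow_le hx m

theorem le_mixedScl {x : G} (hx : x ∈ ⁅(⊤ : Subgroup G), N⁆) {r : ℝ}
    (h : ∀ m : ℕ, m * r ≤ mixedCl N (x ^ m)) : r ≤ mixedScl N x := by
  refine ge_of_tendsto (tendsto_mixedScl hx) ?_
  filter_upwards [eventually_gt_atTop 0] with m hm
  rw [le_div_iff₀ (by exact_mod_cast hm), mul_comm]
  exact h m

theorem mixedCl_map_equiv {H : Type*} [Group H] (e : G ≃* H) (x : G) :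
    mixedCl (N.map e.toMonoidHom) (e x) = mixedCl N x := by
  have key : ∀ c : G, IsMixedCommutator N c ↔ IsMixedCommutator (N.map e.toMonoidHom) (e c) := by
    intro c
    constructor
    · rintro ⟨g, w, hw, rfl⟩
      exact ⟨e g, e w, ⟨w, hw, rfl⟩, map_commutatorElement e g w⟩
    · rintro ⟨g, _, ⟨w, hw, rfl⟩, h⟩
      refine ⟨e.symm g, w, hw, e.injective ?_⟩
      rw [map_commutatorElement, e.apply_symm_apply]
      exact h
  unfold mixedCl
  congr 1
  ext k
  constructor
  · rintro ⟨L, hl, hL, hp⟩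
    refine ⟨L.map e.symm, by simpa using hl, fun c hc => ?_, ?_⟩
    · obtain ⟨d, hd, rfl⟩ := List.mem_map.1 hc
      rw [key, e.apply_symm_apply]
      exact hL d hd
    · rw [← map_list_prod, hp, e.symm_apply_apply]
  · rintro ⟨L, hl, hL, hp⟩
    refine ⟨L.map e, by simpa using hl, fun c hc => ?_, ?_⟩
    · obtain ⟨d, hd, rfl⟩ := List.mem_map.1 hc
      exact (key d).1 (hL d hd)
    · rw [← map_list_prod, hp]

theorem mixedScl_map_equiv {H : Type*} [Group H] (e : G ≃* H) (x : G) :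
    mixedScl (N.map e.toMonoidHom) (e x) = mixedScl N x := by
  unfold mixedScl
  simp only [← map_pow, mixedCl_map_equiv]

theorem map_top_equiv {H : Type*} [Group H] (e : G ≃* H) :
    (⊤ : Subgroup G).map e.toMonoidHom = ⊤ :=
  Subgroup.map_top_of_surjective _ e.surjective

theorem map_commutator_equiv {H : Type*} [Group H] (e : G ≃* H) :
    (commutator G).map e.toMonoidHom = commutator H := by
  rw [commutator_def, commutator_def, Subgroup.map_commutator, map_top_equiv]

/-- Equivalence of `scl_G` and `scl_{G,G'}` is an isomorphism invariant. -/
theorem SclEquivalent.congr {H : Type*} [Group H] (e : G ≃* H)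
    (h : SclEquivalent (commutator H)) : SclEquivalent (commutator G) := by
  obtain ⟨C, hC, h⟩ := h
  refine ⟨C, hC, fun x hx => ?_⟩
  have h1 := h (e x) (by
    rw [← map_commutator_equiv e, ← map_top_equiv e, ← Subgroup.map_commutator]
    exact ⟨x, hx, rfl⟩)
  have h2 := mixedScl_map_equiv (N := (⊤ : Subgroup G)) e x
  rw [map_top_equiv] at h2
  rwa [← map_commutator_equiv e, mixedScl_map_equiv, scl, h2] at h1

end MixedCl

/-! ### The witnesses lie in `[G, G']` and have bounded `scl_G` -/

section Witness

variable {G : Type*} [Group G] {ℓ : ℕ}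

theorem mem_witness_list_isMixedCommutator (a b : Fin ℓ → G) (n : ℕ) :
    ∀ c ∈ List.ofFn fun i : Fin ℓ => ⁅elemY (a i) (b i) ^ n, elemZ ℓ (a i) (b i)⁆,
      IsMixedCommutator (⊤ : Subgroup G) c := by
  intro c hc
  obtain ⟨i, rfl⟩ := (List.mem_ofFn' _ _).1 hc
  exact ⟨_, _, Subgroup.mem_top _, rfl⟩

theorem scl_witness_le (a b : Fin ℓ → G) (n : ℕ) : scl (witness a b n) ≤ ℓ := by
  have hmem : witness a b n ∈ ⁅(⊤ : Subgroup G), (⊤ : Subgroup G)⁆ :=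
    Subgroup.list_prod_mem _ fun c hc => (mem_witness_list_isMixedCommutator a b n c hc).mem
  refine (mixedScl_le_mixedCl hmem).trans ?_
  have := mixedCl_le_of_list _ (mem_witness_list_isMixedCommutator a b n) rfl
  rw [List.length_ofFn] at this
  exact_mod_cast this

theorem prod_ofFn_zpow_of_commute {m : ℕ} (f : Fin m → G) (hf : ∀ i x, Commute (f i) x)
    (k : ℤ) : (List.ofFn fun i => f i ^ k).prod = (List.ofFn f).prod ^ k := by
  induction m with
  | zero => simp
  | succ m ih =>
    rw [List.ofFn_succ, List.prod_cons, List.ofFn_succ, List.prod_cons,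
      ih (fun i => f i.succ) fun i x => hf _ _, (hf 0 _).mul_zpow]

theorem commutator_mul_left_of_central (h : ∀ x y z : G, Commute ⁅x, y⁆ z) (x y z : G) :
    ⁅x * y, z⁆ = ⁅x, z⁆ * ⁅y, z⁆ := by
  have := (h y z (x⁻¹)).eq
  calc ⁅x * y, z⁆ = x * (⁅y, z⁆ * x⁻¹) * ⁅x, z⁆ := by simp only [commutatorElement_def]; group
    _ = ⁅y, z⁆ * ⁅x, z⁆ := by rw [this]; group
    _ = ⁅x, z⁆ * ⁅y, z⁆ := (h y z _).eq

/-- In a group whose commutators are central, `x ↦ ⁅x, z⁆` is a homomorphism. -/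
def commutatorHom (h : ∀ x y z : G, Commute ⁅x, y⁆ z) (z : G) : G →* G where
  toFun x := ⁅x, z⁆
  map_one' := by simp
  map_mul' x y := commutator_mul_left_of_central h x y z

theorem commutator_zpow_zpow_of_central (h : ∀ x y z : G, Commute ⁅x, y⁆ z) (x y : G) (m k : ℤ) :
    ⁅x ^ m, y ^ k⁆ = ⁅x, y⁆ ^ (m * k) := by
  have h1 : ∀ (x y : G) (m : ℤ), ⁅x ^ m, y⁆ = ⁅x, y⁆ ^ m := fun x y m =>
    map_zpow (commutatorHom h y) x m
  rw [h1, ← commutatorElement_inv, h1, ← commutatorElement_inv x y, ← zpow_neg_one,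
    ← zpow_neg_one ⁅x, y⁆, ← zpow_mul, ← zpow_mul, ← zpow_mul]
  congr 1
  ring

theorem commutator_conj_conj (g x y : G) : ⁅g * x * g⁻¹, g * y * g⁻¹⁆ = g * ⁅x, y⁆ * g⁻¹ := by
  simp only [commutatorElement_def]; group

theorem commutator_elemY_elemZ (a b : G) (n : ℕ) :
    ⁅elemY a b ^ n, elemZ ℓ a b⁆ =
      (b * a ^ 2) * ⁅b ^ (-(n : ℤ)), a ^ (-(ℓ : ℤ))⁆ * (b * a ^ 2)⁻¹ := by
  rw [← commutator_conj_conj, elemY, elemZ, conj_pow, inv_pow, ← zpow_natCast b, ← zpow_natCast a ℓ,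
    zpow_neg, zpow_neg]

/-- Conjugation is trivial on central commutators and the commutator pairing is bimultiplicative, so
the whole product is the (-nℓ)-th power of the surface relator. -/
theorem witness_eq_one_of_central (h : ∀ x y z : G, Commute ⁅x, y⁆ z) (a b : Fin ℓ → G)
    (hab : (List.ofFn fun i => ⁅a i, b i⁆).prod = 1) (n : ℕ) : witness a b n = 1 := by
  have key : ∀ i, ⁅elemY (a i) (b i) ^ n, elemZ ℓ (a i) (b i)⁆ = ⁅a i, b i⁆ ^ (-(n * ℓ : ℤ)) := by
    intro i
    rw [commutator_elemY_elemZ, commutator_zpow_zpow_of_central h, ← commutatorElement_inv,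
      inv_zpow', ← ((h _ _ _).zpow_left _).eq, mul_inv_cancel_right]
    simp
  simp only [witness, key]
  rw [prod_ofFn_zpow_of_commute _ fun i x => h _ _ _, hab, one_zpow]

theorem map_witness {H : Type*} [Group H] (φ : G →* H) (a b : Fin ℓ → G) (n : ℕ) :
    φ (witness a b n) = witness (fun i => φ (a i)) (fun i => φ (b i)) n := by
  simp only [witness, map_list_prod, List.map_ofFn]
  congr 2
  funext i
  simp [elemY, elemZ, map_commutatorElement]

/-- G/[G,G'] has central commutators, so the witness dies there. -/
theorem witness_mem (a b : Fin ℓ → G) (hab : (List.ofFn fun i => ⁅a i, b i⁆).prod = 1) (n : ℕ) :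
    witness a b n ∈ ⁅(⊤ : Subgroup G), commutator G⁆ := by
  let π := QuotientGroup.mk' ⁅(⊤ : Subgroup G), commutator G⁆
  rw [← QuotientGroup.ker_mk' ⁅(⊤ : Subgroup G), commutator G⁆, MonoidHom.mem_ker, map_witness]
  apply witness_eq_one_of_central
  · intro x y z
    obtain ⟨x, rfl⟩ := QuotientGroup.mk'_surjective _ x
    obtain ⟨y, rfl⟩ := QuotientGroup.mk'_surjective _ y
    obtain ⟨z, rfl⟩ := QuotientGroup.mk'_surjective _ z
    refine Commute.symm (commutatorElement_eq_one_iff_commute.1 ?_)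
    rw [← map_commutatorElement, ← map_commutatorElement, ← MonoidHom.mem_ker,
      QuotientGroup.ker_mk']
    exact Subgroup.commutator_mem_commutator (Subgroup.mem_top _)
      (Subgroup.commutator_mem_commutator (Subgroup.mem_top _) (Subgroup.mem_top _))
  · have := congrArg π hab
    rw [map_list_prod, List.map_ofFn, map_one] at this
    rw [← this]
    congr 2

end Witness

/-! ### A twisted product with `ℤ × ℤ` -/

/-- The product `C × ℤ × ℤ` with multiplication
`(x, m, n) (x', m', n') = (x x' c ^ (m n'), m + m', n + n')`, where `c` is central in `C`. -/
@[ext]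
structure Twisted (C : Type*) [Group C] (c : Subgroup.center C) where
  /-- The component in the base group. -/
  base : C
  /-- The first integer coordinate. -/
  fst : ℤ
  /-- The second integer coordinate. -/
  snd : ℤ

namespace Twisted

variable {C : Type*} [Group C] {c : Subgroup.center C}

theorem commute_zpow (k : ℤ) (x : C) : Commute ((c : C) ^ k) x :=
  Commute.zpow_left (Commute.symm (Subgroup.mem_center_iff.1 c.2 x)) k

instance : Mul (Twisted C c) :=
  ⟨fun p q => ⟨p.base * q.base * (c : C) ^ (p.fst * q.snd), p.fst + q.fst, p.snd + q.snd⟩⟩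

instance : One (Twisted C c) := ⟨⟨1, 0, 0⟩⟩

instance : Inv (Twisted C c) :=
  ⟨fun p => ⟨p.base⁻¹ * (c : C) ^ (p.fst * p.snd), -p.fst, -p.snd⟩⟩

theorem base_mul (p q : Twisted C c) :
    (p * q).base = p.base * q.base * (c : C) ^ (p.fst * q.snd) := rfl

@[simp] theorem fst_mul (p q : Twisted C c) : (p * q).fst = p.fst + q.fst := rfl

@[simp] theorem snd_mul (p q : Twisted C c) : (p * q).snd = p.snd + q.snd := rfl

@[simp] theorem base_one : (1 : Twisted C c).base = 1 := rfl

@[simp] theorem fst_one : (1 : Twisted C c).fst = 0 := rfl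

@[simp] theorem snd_one : (1 : Twisted C c).snd = 0 := rfl

theorem base_inv (p : Twisted C c) : p⁻¹.base = p.base⁻¹ * (c : C) ^ (p.fst * p.snd) := rfl

@[simp] theorem fst_inv (p : Twisted C c) : p⁻¹.fst = -p.fst := rfl

@[simp] theorem snd_inv (p : Twisted C c) : p⁻¹.snd = -p.snd := rfl

instance : Group (Twisted C c) :=
  Group.ofLeftAxioms
    (fun p q r => by
      ext
      · simp only [base_mul, fst_mul, snd_mul]
        rw [mul_assoc (p.base * q.base), (commute_zpow _ r.base).eq]
        simp only [mul_assoc, ← zpow_add]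
        congr 4
        ring
      · simp [add_assoc]
      · simp [add_assoc])
    (fun p => by ext <;> simp [base_mul])
    (fun p => by
      ext
      · simp only [base_mul, base_inv, fst_inv, base_one]
        rw [mul_assoc p.base⁻¹, (commute_zpow _ p.base).eq, mul_assoc, mul_assoc, ← zpow_add]
        simp
      · simp
      · simp)

/-- The projection of the twisted product to the first integer coordinate. -/
def fstHom : Twisted C c →* Multiplicative ℤ where
  toFun p := Multiplicative.ofAdd p.fst
  map_one' := rfl
  map_mul' _ _ := rfl

/-- The projection of the twisted product to the second integer coordinate. -/
def sndHom : Twisted C c →* Multiplicative ℤ where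
  toFun p := Multiplicative.ofAdd p.snd
  map_one' := rfl
  map_mul' _ _ := rfl

/-- The inclusion of the base group into the twisted product. -/
def incl : C →* Twisted C c where
  toFun x := ⟨x, 0, 0⟩
  map_one' := rfl
  map_mul' x y := by ext <;> simp [base_mul]

/-- The cocycle m n' antisymmetrizes to the determinant m n' - m' n; this is the only trace that the
integer coordinates leave in a commutator. -/
theorem commutator_eq (p q : Twisted C c) :
    ⁅p, q⁆ = incl (⁅p.base, q.base⁆ * (c : C) ^ (p.fst * q.snd - q.fst * p.snd)) := by
  -- Comparing pq with qp avoids computing inverses.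
  rw [commutatorElement_def, mul_assoc, ← mul_inv_rev, mul_inv_eq_iff_eq_mul]
  ext
  · simp only [base_mul, incl, MonoidHom.coe_mk, OneHom.coe_mk, zero_mul, zpow_zero, mul_one,
      mul_assoc]
    rw [(commute_zpow _ _).eq]
    simp only [commutatorElement_def, mul_assoc, ← zpow_add, inv_mul_cancel_left]
    congr 3
    ring
  · simp [incl, add_comm]
  · simp [incl, add_comm]

theorem exists_incl_of_mem_commutator {p : Twisted C c} (hp : p ∈ commutator (Twisted C c)) :
    ∃ x : C, p = incl x := by
  have h : commutator (Twisted C c) ≤ (incl (c := c)).range := by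
    rw [commutator_def, Subgroup.commutator_le]
    intro p _ q _
    exact ⟨_, (commutator_eq p q).symm⟩
  obtain ⟨x, rfl⟩ := h hp
  exact ⟨x, rfl⟩

end Twisted

/-! ### The translation number as a quasimorphism -/

section TranslationNumber

open CircleDeg1Lift

/-- The translation number on the group of lifts of circle homeomorphisms. -/
def rot (f : CircleDeg1Liftˣ) : ℝ := translationNumber (f : CircleDeg1Lift)

theorem rot_one : rot 1 = 0 := translationNumber_one

theorem rot_pow (f : CircleDeg1Liftˣ) (n : ℕ) : rot (f ^ n) = n * rot f := by
  simp [rot]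

theorem rot_zpow (f : CircleDeg1Liftˣ) (n : ℤ) : rot (f ^ n) = n * rot f :=
  translationNumber_zpow f n

theorem rot_inv (f : CircleDeg1Liftˣ) : rot f⁻¹ = -rot f := translationNumber_units_inv f

theorem rot_conj (f g : CircleDeg1Liftˣ) : rot (f * g * f⁻¹) = rot g := by
  simp [rot]

theorem rot_mul_of_commute {f g : CircleDeg1Liftˣ} (h : Commute f g) :
    rot (f * g) = rot f + rot g := by
  have : Commute (f : CircleDeg1Lift) g := by
    have := congrArg Units.val h.eq
    exact this
  exact translationNumber_mul_of_commute this

/-- Each of the three translation numbers differs by at most 1 from the displacement of 0, and these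
displacements are additive up to 1. -/
theorem abs_rot_mul_sub_le (f g : CircleDeg1Liftˣ) : |rot (f * g) - rot f - rot g| ≤ 4 := by
  have h1 := dist_map_zero_translationNumber_le (f : CircleDeg1Lift)
  have h2 := dist_map_zero_translationNumber_le (g : CircleDeg1Lift)
  have h3 := dist_map_zero_translationNumber_le (f * g : CircleDeg1Lift)
  have h4 := dist_map_map_zero_lt (f : CircleDeg1Lift) g
  rw [Real.dist_eq, abs_le] at h1 h2 h3
  rw [Real.dist_eq, abs_lt] at h4
  rw [mul_apply] at h3
  simp only [rot, Units.val_mul]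
  rw [abs_le]
  constructor <;> linarith [h1.1, h1.2, h2.1, h2.2, h3.1, h3.2, h4.1, h4.2]

/-- The commutator is a product of a conjugate of g with g⁻¹, whose translation numbers cancel; only
the defect remains. -/
theorem abs_rot_commutator_le (f g : CircleDeg1Liftˣ) : |rot ⁅f, g⁆| ≤ 4 := by
  have := abs_rot_mul_sub_le (f * g * f⁻¹) g⁻¹
  rwa [rot_conj, rot_inv, sub_neg_eq_add, sub_add_cancel] at this

/-- Each factor costs at most 4 for its own value and 4 for the defect. -/
theorem abs_rot_list_prod_le (L : List CircleDeg1Liftˣ) (hL : ∀ f ∈ L, |rot f| ≤ 4) :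
    |rot L.prod| ≤ 8 * L.length := by
  induction L with
  | nil => simp [rot_one]
  | cons f L ih =>
    have h1 := abs_le.1 (ih fun g hg => hL g (List.mem_cons_of_mem f hg))
    have h2 := abs_le.1 (hL f List.mem_cons_self)
    have h3 := abs_le.1 (abs_rot_mul_sub_le f L.prod)
    rw [List.prod_cons, List.length_cons, abs_le]
    push_cast
    constructor <;> linarith [h1.1, h1.2, h2.1, h2.2, h3.1, h3.2]

end TranslationNumber

/-! ### The lower bound for the mixed stable commutator length -/

section LowerBound

variable {G : Type*} [Group G] {c : Subgroup.center CircleDeg1Liftˣ}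

theorem exists_incl_of_mem (φ : G →* Twisted CircleDeg1Liftˣ c) {x : G} (hx : x ∈ commutator G) :
    ∃ f, φ x = Twisted.incl f := by
  apply Twisted.exists_incl_of_mem_commutator
  have : φ x ∈ (commutator G).map φ := ⟨x, hx, rfl⟩
  rw [commutator_def, Subgroup.map_commutator] at this
  exact Subgroup.commutator_mono le_top le_top this

theorem abs_rot_le_mixedCl (φ : G →* Twisted CircleDeg1Liftˣ c) {x : G}
    (hx : x ∈ ⁅(⊤ : Subgroup G), commutator G⁆) :
    |rot (φ x).base| ≤ 8 * mixedCl (commutator G) x := by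
  obtain ⟨L, hl, hL, rfl⟩ := exists_list_length_eq_mixedCl hx
  have key : ∀ y : G, IsMixedCommutator (commutator G) y →
      ∃ f : CircleDeg1Liftˣ, φ y = Twisted.incl f ∧ |rot f| ≤ 4 := by
    rintro y ⟨g, w, hw, rfl⟩
    obtain ⟨f, hf⟩ := exists_incl_of_mem φ hw
    refine ⟨_, by rw [map_commutatorElement, Twisted.commutator_eq], ?_⟩
    -- Since w lies in G', its integer coordinates vanish, and with them the determinant: no power
    -- of c appears.
    have h1 : (φ w).fst = 0 := by rw [hf]; rfl
    have h2 : (φ w).snd = 0 := by rw [hf]; rfl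
    simp only [h1, h2, mul_zero, zero_mul, sub_zero, zpow_zero, mul_one]
    exact abs_rot_commutator_le _ _
  have : ∃ M : List CircleDeg1Liftˣ, M.length = L.length ∧ (∀ f ∈ M, |rot f| ≤ 4) ∧
      φ L.prod = Twisted.incl M.prod := by
    clear hl hx
    induction L with
    | nil => exact ⟨[], rfl, by simp, by simp⟩
    | cons y L ih =>
      obtain ⟨M, h1, h2, h3⟩ := ih fun d hd => hL d (List.mem_cons_of_mem y hd)
      obtain ⟨f, hf, hf4⟩ := key y (hL y List.mem_cons_self)
      refine ⟨f :: M, by simp [h1], ?_, by simp [h3, hf]⟩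
      intro g hg
      rcases List.mem_cons.1 hg with rfl | hg
      exacts [hf4, h2 g hg]
  obtain ⟨M, h1, h2, h3⟩ := this
  rw [h3, ← hl, ← h1]
  exact abs_rot_list_prod_le M h2

/-- On elements of zero integer coordinates the base is multiplicative, so homogeneity of `rot`
makes the bound linear along powers of x. -/
theorem abs_rot_le_mixedScl (φ : G →* Twisted CircleDeg1Liftˣ c) {x : G}
    (hx : x ∈ ⁅(⊤ : Subgroup G), commutator G⁆) :
    |rot (φ x).base| / 8 ≤ mixedScl (commutator G) x := by
  refine le_mixedScl hx fun m => ?_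
  have h := abs_rot_le_mixedCl φ (pow_mem hx m)
  obtain ⟨f, hf⟩ := exists_incl_of_mem φ (Subgroup.commutator_le_right _ _ hx)
  have h1 : (φ (x ^ m)).base = f ^ m := by rw [map_pow, hf, ← map_pow]; rfl
  have h2 : (φ x).base = f := by rw [hf]; rfl
  rw [h1, rot_pow, abs_mul, Nat.abs_cast] at h
  rw [h2]
  linarith

variable {ℓ : ℕ}

/-- Integer coordinates attached to the generators: only the first handle carries a nonzero one. -/
def handleWeight (i : Fin ℓ) : ℤ := if (i : ℕ) = 0 then 1 else 0

theorem fst_zpow (p : Twisted CircleDeg1Liftˣ c) (k : ℤ) : (p ^ k).fst = k * p.fst := by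
  have := congrArg Multiplicative.toAdd (map_zpow (Twisted.fstHom (c := c)) p k)
  rw [toAdd_zpow, smul_eq_mul] at this
  exact this

theorem snd_zpow (p : Twisted CircleDeg1Liftˣ c) (k : ℤ) : (p ^ k).snd = k * p.snd := by
  have := congrArg Multiplicative.toAdd (map_zpow (Twisted.sndHom (c := c)) p k)
  rw [toAdd_zpow, smul_eq_mul] at this
  exact this

/-- Lifts of the generators to the twisted product. -/
def twistA (c : Subgroup.center CircleDeg1Liftˣ) (a : Fin ℓ → CircleDeg1Liftˣ) (i : Fin ℓ) :
    Twisted CircleDeg1Liftˣ c := ⟨a i, handleWeight i, 0⟩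

/-- Lifts of the generators to the twisted product. -/
def twistB (c : Subgroup.center CircleDeg1Liftˣ) (b : Fin ℓ → CircleDeg1Liftˣ) (i : Fin ℓ) :
    Twisted CircleDeg1Liftˣ c := ⟨b i, 0, handleWeight i⟩

theorem handleWeight_mul_self (i : Fin ℓ) : handleWeight i * handleWeight i = handleWeight i := by
  unfold handleWeight; split <;> simp

theorem prod_ofFn_mul_zpow_handleWeight (hℓ : 0 < ℓ) (f : Fin ℓ → CircleDeg1Liftˣ) (k : ℤ) :
    (List.ofFn fun i => f i * (c : CircleDeg1Liftˣ) ^ (k * handleWeight i)).prod =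
      (List.ofFn f).prod * (c : CircleDeg1Liftˣ) ^ k := by
  obtain ⟨m, rfl⟩ : ∃ m, ℓ = m + 1 := ⟨ℓ - 1, by omega⟩
  simp only [List.ofFn_succ, List.prod_cons, handleWeight, Fin.val_zero, if_true, Fin.val_succ,
    Nat.add_eq_zero_iff, one_ne_zero, and_false, if_false, mul_one, mul_zero, zpow_zero, mul_assoc,
    (Twisted.commute_zpow k (List.ofFn fun i : Fin m => f i.succ).prod).eq]

/-- The first handle has determinant 1 and the others 0, so exactly one factor c is gained, as the
relation requires. -/
theorem prod_commutator_twist (hℓ : 0 < ℓ) (a b : Fin ℓ → CircleDeg1Liftˣ)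
    (h : (List.ofFn fun i => ⁅a i, b i⁆).prod * (c : CircleDeg1Liftˣ) = 1) :
    (List.ofFn fun i => ⁅twistA c a i, twistB c b i⁆).prod = 1 := by
  have : ∀ i, ⁅twistA c a i, twistB c b i⁆ =
      Twisted.incl (⁅a i, b i⁆ * (c : CircleDeg1Liftˣ) ^ (1 * handleWeight i)) := by
    intro i
    rw [Twisted.commutator_eq]
    simp [twistA, twistB, handleWeight_mul_self]
  simp only [this]
  have h2 := prod_ofFn_mul_zpow_handleWeight (c := c) hℓ (fun i => ⁅a i, b i⁆) 1
  rw [zpow_one, h] at h2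
  have h3 := congrArg (Twisted.incl (c := c)) h2
  rw [map_list_prod, List.map_ofFn, map_one] at h3
  exact h3

theorem exists_witness_twist_eq (hℓ : 0 < ℓ) (a b : Fin ℓ → CircleDeg1Liftˣ) (n : ℕ) :
    ∃ f : CircleDeg1Liftˣ, |rot f| ≤ 8 * ℓ ∧ witness (twistA c a) (twistB c b) n =
      Twisted.incl (f * (c : CircleDeg1Liftˣ) ^ (-(n * ℓ : ℤ))) := by
  have : ∀ i, ∃ f : CircleDeg1Liftˣ, |rot f| ≤ 4 ∧
      ⁅elemY (twistA c a i) (twistB c b i) ^ n, elemZ ℓ (twistA c a i) (twistB c b i)⁆ =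
      Twisted.incl (f * (c : CircleDeg1Liftˣ) ^ (-(n * ℓ : ℤ) * handleWeight i)) := by
    intro i
    refine ⟨⁅(elemY (twistA c a i) (twistB c b i) ^ n).base,
      (elemZ ℓ (twistA c a i) (twistB c b i)).base⁆, abs_rot_commutator_le _ _, ?_⟩
    rw [Twisted.commutator_eq]
    congr 3
    rw [← zpow_natCast, fst_zpow, snd_zpow]
    simp only [elemY, elemZ, Twisted.fst_mul, Twisted.snd_mul, Twisted.fst_inv, Twisted.snd_inv,
      ← zpow_natCast, fst_zpow, snd_zpow, twistA, twistB]
    -- With weight w, the integer coordinates of y^n are (0, -nw) and those of z are (-ℓw, 0); the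
    -- determinant is -nℓw², and w² = w.
    have := handleWeight_mul_self i
    linear_combination (-(n * ℓ : ℤ)) * this
  choose f hf hfw using this
  refine ⟨(List.ofFn f).prod, ?_, ?_⟩
  · have := abs_rot_list_prod_le (List.ofFn f) (by
      intro g hg
      obtain ⟨i, rfl⟩ := (List.mem_ofFn' _ _).1 hg
      exact hf i)
    simpa using this
  · simp only [witness, hfw]
    rw [← prod_ofFn_mul_zpow_handleWeight hℓ, map_list_prod, List.map_ofFn]
    rfl

/-- If a group maps to the twisted product by a circle action of nonzero Euler number, the mixed
stable commutator length of the witnesses is unbounded. -/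
theorem tendsto_mixedScl_witness (hℓ : 0 < ℓ) (a b : Fin ℓ → CircleDeg1Liftˣ)
    (hc : rot (c : CircleDeg1Liftˣ) ≠ 0) (A B : Fin ℓ → G)
    (hAB : (List.ofFn fun i => ⁅A i, B i⁆).prod = 1) (φ : G →* Twisted CircleDeg1Liftˣ c)
    (hA : ∀ i, φ (A i) = twistA c a i) (hB : ∀ i, φ (B i) = twistB c b i) :
    Tendsto (fun n => mixedScl (commutator G) (witness A B n)) atTop atTop := by
  have key : ∀ n : ℕ, (n * (ℓ * |rot (c : CircleDeg1Liftˣ)|) - 8 * ℓ) / 8 ≤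
      mixedScl (commutator G) (witness A B n) := by
    intro n
    refine le_trans ?_ (abs_rot_le_mixedScl φ (witness_mem A B hAB n))
    obtain ⟨f, hf, hw⟩ := exists_witness_twist_eq (c := c) hℓ a b n
    rw [map_witness]
    simp only [hA, hB]
    rw [hw]
    change _ ≤ |rot (f * (c : CircleDeg1Liftˣ) ^ (-(n * ℓ : ℤ)))| / 8
    rw [rot_mul_of_commute (Twisted.commute_zpow _ f).symm, rot_zpow]
    push_cast
    have h1 : (n * (ℓ * |rot (c : CircleDeg1Liftˣ)|) : ℝ) =
        |-((n : ℝ) * ℓ) * rot (c : CircleDeg1Liftˣ)| := by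
      rw [abs_mul, abs_neg, abs_mul, Nat.abs_cast, Nat.abs_cast, mul_assoc]
    have h2 := abs_sub_abs_le_abs_sub (-((n : ℝ) * ℓ) * rot (c : CircleDeg1Liftˣ)) (-rot f)
    rw [abs_neg, sub_neg_eq_add, add_comm _ (rot f)] at h2
    linarith
  refine tendsto_atTop_mono key ?_
  have hpos : (0 : ℝ) < ℓ * |rot (c : CircleDeg1Liftˣ)| := by positivity
  exact (tendsto_atTop_add_const_right _ _
    (tendsto_natCast_atTop_atTop.atTop_mul_const hpos)).atTop_div_const (by norm_num)

end LowerBound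

/-! ### A pair of circle homeomorphisms whose commutator is a half turn -/

section Blaschke

open Complex

/-- The exponential covering `ℝ → S¹`, `x ↦ exp (2πix)`. -/
def circleExp (x : ℝ) : ℂ := exp (((2 * Real.pi * x : ℝ) : ℂ) * I)

theorem norm_circleExp (x : ℝ) : ‖circleExp x‖ = 1 := norm_exp_ofReal_mul_I _

theorem circleExp_ne_zero (x : ℝ) : circleExp x ≠ 0 := exp_ne_zero _

theorem circleExp_add (x y : ℝ) : circleExp (x + y) = circleExp x * circleExp y := by
  rw [circleExp, circleExp, circleExp, ← exp_add]
  congr 1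
  push_cast
  ring

theorem circleExp_zero : circleExp 0 = 1 := by simp [circleExp]

theorem circleExp_one : circleExp 1 = 1 := by
  simp [circleExp, exp_two_pi_mul_I]

theorem circleExp_quarter : circleExp (1 / 4) = I := by
  rw [circleExp, show ((2 * Real.pi * (1 / 4) : ℝ) : ℂ) * I = (Real.pi : ℂ) / 2 * I by
    push_cast; ring, exp_pi_div_two_mul_I]

theorem circleExp_neg (x : ℝ) : circleExp (-x) = (circleExp x)⁻¹ := by
  rw [circleExp, circleExp, ← exp_neg]
  congr 1
  push_cast
  ring

theorem circleExp_eq_iff {x y : ℝ} : circleExp x = circleExp y ↔ ∃ n : ℤ, x = y + n := by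
  rw [circleExp, circleExp, exp_eq_exp_iff_exists_int]
  refine exists_congr fun n => ?_
  have h : ((2 * Real.pi * y : ℝ) : ℂ) * I + n * (2 * Real.pi * I) =
      ((2 * Real.pi * (y + n) : ℝ) : ℂ) * I := by
    push_cast; ring
  rw [h, mul_left_inj' I_ne_zero, ofReal_inj, mul_right_inj' (by positivity)]

variable {r : ℝ}

theorem re_one_add_mul_pos (hr : |r| < 1) {z : ℂ} (hz : ‖z‖ = 1) : 0 < (1 + r * z).re := by
  have h1 : |z.re| ≤ 1 := hz ▸ abs_re_le_norm z
  have h2 : |r * z.re| < 1 := by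
    rw [abs_mul]
    exact (mul_le_of_le_one_right (abs_nonneg _) h1).trans_lt hr
  simp only [add_re, one_re, mul_re, ofReal_re, ofReal_im, zero_mul, sub_zero]
  linarith [(abs_lt.1 h2).1]

theorem one_add_mul_ne_zero (hr : |r| < 1) {z : ℂ} (hz : ‖z‖ = 1) : 1 + r * z ≠ 0 := fun h => by
  simpa [h] using re_one_add_mul_pos hr hz

/-- The lift to the line of the Blaschke factor `z ↦ (z + r) / (1 + r z)`. -/
def blaschkeLift (r x : ℝ) : ℝ := x + arg (1 + r * circleExp (-x)) / Real.pi

theorem blaschkeLift_add_one (r x : ℝ) : blaschkeLift r (x + 1) = blaschkeLift r x + 1 := by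
  rw [blaschkeLift, blaschkeLift, neg_add, circleExp_add, circleExp_neg 1, circleExp_one, inv_one,
    mul_one]
  ring

theorem abs_blaschkeLift_sub_lt (hr : |r| < 1) (x : ℝ) : |blaschkeLift r x - x| < 1 / 2 := by
  have h := abs_arg_lt_pi_div_two_iff.2 (Or.inl (re_one_add_mul_pos hr (norm_circleExp (-x))))
  rw [blaschkeLift, add_sub_cancel_left, abs_div, abs_of_pos Real.pi_pos,
    div_lt_iff₀ Real.pi_pos]
  linarith

/-- For |z| = 1 and w = 1 + r z̄ the Blaschke factor equals z·w/w̄, and w/w̄ has argument 2 arg w,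
that is, arg w / π turns. -/
theorem circleExp_blaschkeLift (hr : |r| < 1) (x : ℝ) :
    circleExp (blaschkeLift r x) = (circleExp x + r) / (1 + r * circleExp x) := by
  set w : ℂ := 1 + r * circleExp (-x) with hw
  have hw0 : w ≠ 0 := one_add_mul_ne_zero hr (norm_circleExp _)
  have hv0 := one_add_mul_ne_zero hr (norm_circleExp x)
  have hz0 := circleExp_ne_zero x
  have hconj : (starRingEnd ℂ) w = 1 + r * circleExp x := by
    rw [hw, circleExp, circleExp, map_add, map_mul, map_one, conj_ofReal, ← exp_conj, map_mul,
      conj_ofReal, conj_I]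
    congr 3
    push_cast
    ring
  have h1 : circleExp (arg w / Real.pi) = w / (starRingEnd ℂ) w := by
    have h2 : (‖w‖ : ℂ) * exp (arg w * I) = w := norm_mul_exp_arg_mul_I w
    have h3 : circleExp (arg w / Real.pi) = exp (arg w * I) ^ 2 := by
      rw [circleExp, ← exp_nat_mul]
      congr 1
      have : (Real.pi : ℂ) ≠ 0 := ofReal_ne_zero.2 Real.pi_ne_zero
      push_cast
      field_simp
    have h4 : w * (starRingEnd ℂ) w = (‖w‖ : ℂ) ^ 2 := mul_conj' w
    have hc0 : (starRingEnd ℂ) w ≠ 0 := by simpa using hw0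
    rw [h3, eq_div_iff hc0]
    have hn : (‖w‖ : ℂ) ≠ 0 := by simpa using hw0
    apply mul_left_cancel₀ hw0
    calc w * (exp (arg w * I) ^ 2 * (starRingEnd ℂ) w)
        = (w * (starRingEnd ℂ) w) * exp (arg w * I) ^ 2 := by ring
      _ = ((‖w‖ : ℂ) * exp (arg w * I)) ^ 2 := by rw [h4]; ring
      _ = w * w := by rw [h2]; ring
  rw [blaschkeLift, circleExp_add, h1, hconj, hw, circleExp_neg]
  field_simp

/-- The composite covers the identity, so it is an integer translation; both factors move points by
less than 1/2, so that integer is 0. -/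
theorem blaschkeLift_neg_blaschkeLift (hr : |r| < 1) (x : ℝ) :
    blaschkeLift (-r) (blaschkeLift r x) = x := by
  have hr' : |-r| < 1 := by rwa [abs_neg]
  have h : circleExp (blaschkeLift (-r) (blaschkeLift r x)) = circleExp x := by
    have hv0 := one_add_mul_ne_zero hr (norm_circleExp x)
    have hu0 := one_add_mul_ne_zero hr' (norm_circleExp (blaschkeLift r x))
    have hq := circleExp_blaschkeLift hr x
    rw [eq_div_iff hv0] at hq
    rw [circleExp_blaschkeLift hr', div_eq_iff hu0]
    push_cast
    linear_combination hq
  obtain ⟨n, hn⟩ := circleExp_eq_iff.1 h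
  have h1 := abs_lt.1 (abs_blaschkeLift_sub_lt hr x)
  have h2 := abs_lt.1 (abs_blaschkeLift_sub_lt hr' (blaschkeLift r x))
  have h3 : (-1 : ℝ) < n ∧ (n : ℝ) < 1 := ⟨by linarith [h1.1, h2.1], by linarith [h1.2, h2.2]⟩
  have h4 : n = 0 := by
    have h5 : -1 < n := by exact_mod_cast h3.1
    have h6 : n < 1 := by exact_mod_cast h3.2
    omega
  rw [hn, h4]
  simp

theorem continuous_blaschkeLift (hr : |r| < 1) : Continuous (blaschkeLift r) := by
  unfold blaschkeLift
  refine continuous_id.add (Continuous.div_const ?_ _)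
  rw [continuous_iff_continuousAt]
  intro x
  have hc : Continuous fun x : ℝ => 1 + (r : ℂ) * circleExp (-x) := by
    unfold circleExp; fun_prop
  exact (continuousAt_arg (Or.inl (re_one_add_mul_pos hr (norm_circleExp (-x))))).comp
    (f := fun x : ℝ => 1 + (r : ℂ) * circleExp (-x)) hc.continuousAt

/-- A continuous injection of the line is strictly monotone or antitone, and f(x + 1) = f(x) + 1
excludes the latter. -/
theorem monotone_blaschkeLift (hr : |r| < 1) : Monotone (blaschkeLift r) := by
  rcases (continuous_blaschkeLift hr).strictMono_of_inj
    (Function.LeftInverse.injective (blaschkeLift_neg_blaschkeLift hr)) with h | h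
  · exact h.monotone
  · have h1 := h (zero_lt_one' ℝ)
    have h2 := blaschkeLift_add_one r 0
    rw [zero_add] at h2
    linarith

/-- The lift of a Blaschke factor as a degree one lift. -/
def blaschkeDeg1 (r : ℝ) (hr : |r| < 1) : CircleDeg1Lift :=
  ⟨⟨blaschkeLift r, monotone_blaschkeLift hr⟩, blaschkeLift_add_one r⟩

/-- The lift of a Blaschke factor as an invertible degree one lift. -/
def blaschkeUnit (r : ℝ) (hr : |r| < 1) : CircleDeg1Liftˣ where
  val := blaschkeDeg1 r hr
  inv := blaschkeDeg1 (-r) (by rwa [abs_neg])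
  val_inv := by
    ext x
    have := blaschkeLift_neg_blaschkeLift (r := -r) (by rwa [abs_neg]) x
    rw [neg_neg] at this
    exact this
  inv_val := by
    ext x
    exact blaschkeLift_neg_blaschkeLift hr x

/-- The conjugate of the lift of a Blaschke factor by the quarter turn. -/
def blaschkeTurn (r : ℝ) (hr : |r| < 1) : CircleDeg1Liftˣ :=
  CircleDeg1Lift.translate (Multiplicative.ofAdd (1 / 4)) * blaschkeUnit r hr *
    (CircleDeg1Lift.translate (Multiplicative.ofAdd (1 / 4)))⁻¹

theorem circleExp_blaschkeUnit (hr : |r| < 1) (x : ℝ) :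
    circleExp (blaschkeUnit r hr x) = (circleExp x + r) / (1 + r * circleExp x) :=
  circleExp_blaschkeLift hr x

theorem one_sub_mul_I_ne_zero (hr : |r| < 1) {z : ℂ} (hz : ‖z‖ = 1) : 1 - r * I * z ≠ 0 := by
  have := one_add_mul_ne_zero hr (z := -(I * z)) (by simp [hz])
  convert this using 1
  ring

theorem circleExp_blaschkeTurn (hr : |r| < 1) (x : ℝ) :
    circleExp (blaschkeTurn r hr x) =
      (circleExp x + r * I) / (1 - r * I * circleExp x) := by
  have h : blaschkeTurn r hr x = 1 / 4 + blaschkeUnit r hr (-(1 / 4) + x) := by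
    simp [blaschkeTurn, CircleDeg1Lift.mul_apply]
  rw [h, circleExp_add, circleExp_blaschkeUnit, circleExp_add, circleExp_neg, circleExp_quarter,
    inv_I]
  have h0 := one_sub_mul_I_ne_zero hr (norm_circleExp x)
  have h1 : (1 : ℂ) + r * (-I * circleExp x) ≠ 0 := by
    convert h0 using 1; ring
  rw [mul_div_assoc', div_eq_div_iff h1 h0]
  linear_combination (-circleExp x + r * I * circleExp x * circleExp x) * I_sq

/-- For `r ^ 4 + 2 * r ^ 2 = 1` the commutator of the two maps covers an involution. -/
theorem circleExp_commutator (hr : |r| < 1) (hr4 : r ^ 4 + 2 * r ^ 2 = 1) (x : ℝ) :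
    circleExp ((⁅blaschkeUnit r hr, blaschkeTurn r hr⁆ : CircleDeg1Liftˣ) x) *
      (1 - (1 - I) * r * circleExp x) = (1 + I) * r - circleExp x := by
  set a := blaschkeUnit r hr
  set b := blaschkeTurn r hr
  -- With x = b(a(y)) the commutator sends x to a(b(y)), so no inverse maps need to be evaluated.
  obtain ⟨y, rfl⟩ : ∃ y, (b * a : CircleDeg1Liftˣ) y = x :=
    ⟨(b * a)⁻¹ x, CircleDeg1Lift.units_apply_inv_apply (b * a) x⟩
  have hab : (⁅a, b⁆ : CircleDeg1Liftˣ) ((b * a : CircleDeg1Liftˣ) y) = a (b y) := by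
    have h : ⁅a, b⁆ * (b * a) = a * b := by rw [commutatorElement_def]; group
    exact congrArg (fun f : CircleDeg1Liftˣ => f y) h
  have hba : (b * a : CircleDeg1Liftˣ) y = b (a y) := rfl
  rw [hab, hba]
  have hp0 := one_add_mul_ne_zero hr (norm_circleExp y)
  have hq0 := one_sub_mul_I_ne_zero hr (norm_circleExp y)
  have hP0 := one_add_mul_ne_zero hr (norm_circleExp (b y))
  have hS0 := one_sub_mul_I_ne_zero hr (norm_circleExp (a y))
  have hp := circleExp_blaschkeUnit hr y
  have hq := circleExp_blaschkeTurn hr y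
  have hP := circleExp_blaschkeUnit hr (b y)
  have hS := circleExp_blaschkeTurn hr (a y)
  rw [eq_div_iff hp0] at hp
  rw [eq_div_iff hq0] at hq
  rw [eq_div_iff hP0] at hP
  rw [eq_div_iff hS0] at hS
  change circleExp (a y) * _ = _ at hp
  change circleExp (b y) * _ = _ at hq
  change circleExp (a (b y)) * _ = _ at hP
  change circleExp (b (a y)) * _ = _ at hS
  generalize circleExp (a y) = p at *
  generalize circleExp (b y) = q at *
  generalize circleExp (a (b y)) = P at *
  generalize circleExp (b (a y)) = S at *
  generalize circleExp y = z at *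
  have hr4' : (r : ℂ) ^ 4 + 2 * r ^ 2 = 1 := by exact_mod_cast hr4
  generalize (r : ℂ) = s at *
  -- P = a(b(y)) and S = b(a(y)) are now expressed as Möbius images of z; the claim becomes a
  -- polynomial identity modulo I² = -1 and the equation for s.
  have hV : P * ((1 - s * I * z) + s * (z + s * I)) = (z + s * I) + s * (1 - s * I * z) := by
    linear_combination (1 - s * I * z) * hP - (P * s - 1) * hq
  have hU : S * ((1 + s * z) - s * I * (z + s)) = (z + s) + s * I * (1 + s * z) := by
    linear_combination (1 + s * z) * hS + (S * s * I + 1) * hp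
  have hV0 : (1 - s * I * z) + s * (z + s * I) ≠ 0 := by
    have : (1 - s * I * z) + s * (z + s * I) = (1 + s * q) * (1 - s * I * z) := by
      linear_combination -s * hq
    rw [this]
    exact mul_ne_zero hP0 hq0
  have hU0 : (1 + s * z) - s * I * (z + s) ≠ 0 := by
    have : (1 + s * z) - s * I * (z + s) = (1 - s * I * p) * (1 + s * z) := by
      linear_combination s * I * hp
    rw [this]
    exact mul_ne_zero hS0 hp0
  apply mul_left_cancel₀ (mul_ne_zero hV0 hU0)
  linear_combination ((1 + s * z) - s * I * (z + s)) * (1 - (1 - I) * s * S) * hV +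
    (((1 - s * I * z) + s * (z + s * I)) -
      (1 - I) * s * ((z + s * I) + s * (1 - s * I * z))) * hU -
    ((1 - I) * s * z ^ 2 + 2 * z + s * (1 + I)) * hr4' +
    ((s ^ 3 + s ^ 5) * (1 + z ^ 2 + I - z ^ 2 * I) + 2 * (s ^ 2 + s ^ 4) * z) * I_sq

end Blaschke

/-- The integer f(x) - x cannot jump: monotonicity and f(x + 1) = f(x) + 1 pin it down on a period.
-/
theorem exists_eq_add_int_of_circleExp_eq {f : CircleDeg1Liftˣ}
    (hf : ∀ x, circleExp (f x) = circleExp x) :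
    ∃ k : ℤ, ∀ x, f x = x + k := by
  have h : ∀ x, ∃ n : ℤ, f x = x + n := fun x => circleExp_eq_iff.1 (hf x)
  choose n hn using h
  have mono : ∀ x y, x ≤ y → y < x + 1 → n x = n y := by
    intro x y hxy hyx
    have h1 : f x ≤ f y := (f : CircleDeg1Lift).monotone hxy
    have h2 : f y ≤ f (x + 1) := (f : CircleDeg1Lift).monotone hyx.le
    rw [CircleDeg1Lift.map_add_one] at h2
    rw [hn, hn] at h1 h2
    have h3 : (n x : ℝ) < n y + 1 := by linarith
    have h4 : (n y : ℝ) ≤ n x + 1 + (x - y) := by linarith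
    rcases hxy.eq_or_lt with rfl | hlt
    · rfl
    · have h5 : (n y : ℝ) < n x + 1 := by linarith
      have h6 : n x < n y + 1 := by exact_mod_cast h3
      have h7 : n y < n x + 1 := by exact_mod_cast h5
      omega
  refine ⟨n 0, fun x => ?_⟩
  have h1 := (f : CircleDeg1Lift).map_fract_sub_fract_eq x
  have h2 := mono 0 (Int.fract x) (Int.fract_nonneg x) (by simpa using Int.fract_lt_one x)
  rw [hn (Int.fract x), ← h2] at h1
  linarith

theorem mem_center_of_eq_add_int {f : CircleDeg1Liftˣ} {k : ℤ} (hf : ∀ x, f x = x + k) :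
    f ∈ Subgroup.center CircleDeg1Liftˣ := by
  rw [Subgroup.mem_center_iff]
  intro g
  ext x
  change g (f x) = f (g x)
  rw [hf, hf, CircleDeg1Lift.map_add_int]

/-- The commutator covers a Möbius map of trace zero, hence an involution of the circle, so its
square is an integer translation. The integer is nonzero because the involution does not fix 1. -/
theorem exists_sq_commutator_central :
    ∃ a b : CircleDeg1Liftˣ, ⁅a, b⁆ * ⁅a, b⁆ ∈ Subgroup.center CircleDeg1Liftˣ ∧
      rot (⁅a, b⁆ * ⁅a, b⁆) ≠ 0 := by
  obtain ⟨r, hr0, hr1, hr4⟩ : ∃ r : ℝ, 0 < r ∧ r < 1 ∧ r ^ 4 + 2 * r ^ 2 = 1 := by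
    have hcont : ContinuousOn (fun r : ℝ => r ^ 4 + 2 * r ^ 2) (Set.Icc 0 1) := by fun_prop
    obtain ⟨r, hr, h⟩ := intermediate_value_Ioo (zero_le_one' ℝ) hcont
      (show (1 : ℝ) ∈ _ by norm_num)
    exact ⟨r, hr.1, hr.2, h⟩
  have hr : |r| < 1 := by rwa [abs_of_pos hr0]
  refine ⟨blaschkeUnit r hr, blaschkeTurn r hr, ?_⟩
  have key := circleExp_commutator hr hr4
  set g := ⁅blaschkeUnit r hr, blaschkeTurn r hr⁆
  -- Numerator and denominator of the involution have no common zero: this would force 2r² = 1,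
  -- hence r⁴ = 0.
  have hne : ∀ z : ℂ, 1 - (1 - Complex.I) * r * z = 0 → (1 + Complex.I) * r - z = 0 → False := by
    intro z h1 h2
    have h3 : 1 - 2 * (r : ℂ) ^ 2 = 0 := by
      linear_combination h1 - (1 - Complex.I) * r * h2 - r ^ 2 * Complex.I_sq
    have h4 : 1 - 2 * r ^ 2 = 0 := by exact_mod_cast h3
    nlinarith
  have hsq : ∀ x, circleExp ((g * g : CircleDeg1Liftˣ) x) = circleExp x := by
    intro x
    have h1 := key x
    have h2 := key (g x)
    change circleExp (g (g x)) = _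
    generalize circleExp (g (g x)) = u at *
    generalize circleExp (g x) = v at *
    generalize circleExp x = z at *
    have h3 : 1 - (1 - Complex.I) * r * v ≠ 0 := fun h =>
      hne v h (by rw [← h2, h, mul_zero])
    apply mul_right_cancel₀ h3
    linear_combination h2 - h1
  obtain ⟨k, hk⟩ := exists_eq_add_int_of_circleExp_eq hsq
  refine ⟨mem_center_of_eq_add_int hk, ?_⟩
  have hrot : rot (g * g) = k :=
    CircleDeg1Lift.translationNumber_of_eq_add_int (f := ((g * g : CircleDeg1Liftˣ) :)) (hk 0)
  rw [hrot]
  intro hk0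
  -- A monotone map whose square fixes 0 fixes 0.
  have hfix : g 0 = 0 := by
    have h1 : g (g 0) = 0 := by
      have := hk 0
      rw [hk0, add_zero] at this
      exact this
    have hm := (g : CircleDeg1Lift).monotone
    rcases le_total (g 0) 0 with h | h
    · have h2 : g (g 0) ≤ g 0 := hm h
      exact le_antisymm h (h1.ge.trans h2)
    · have h2 : g 0 ≤ g (g 0) := hm h
      exact le_antisymm (h2.trans h1.le) h
  have h := key 0
  rw [hfix, circleExp_zero] at h
  have h2 : 2 * (r : ℂ) = 2 := by linear_combination -h
  have h3 : 2 * r = 2 := by exact_mod_cast h2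
  linarith

/-- For `ℓ ≥ 2` there are lifts of circle homeomorphisms whose product of commutators is a nonzero
integer translation. -/
theorem exists_prod_commutator_central {ℓ : ℕ} (hℓ : 2 ≤ ℓ) :
    ∃ (a b : Fin ℓ → CircleDeg1Liftˣ) (c : Subgroup.center CircleDeg1Liftˣ),
      (List.ofFn fun i => ⁅a i, b i⁆).prod * (c : CircleDeg1Liftˣ) = 1 ∧
      rot (c : CircleDeg1Liftˣ) ≠ 0 := by
  obtain ⟨m, rfl⟩ : ∃ m, ℓ = m + 2 := ⟨ℓ - 2, by omega⟩
  obtain ⟨a, b, hc, hrot⟩ := exists_sq_commutator_central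
  -- The same pair sits on the first two handles, all other generators act trivially, and c is the
  -- inverse of the squared commutator.
  refine ⟨fun i => if (i : ℕ) < 2 then a else 1, fun i => if (i : ℕ) < 2 then b else 1,
    ⟨_, inv_mem hc⟩, ?_, ?_⟩
  · have h : (List.ofFn fun i : Fin (m + 2) =>
        ⁅if (i : ℕ) < 2 then a else 1, if (i : ℕ) < 2 then b else 1⁆).prod = ⁅a, b⁆ * ⁅a, b⁆ := by
      simp [List.ofFn_succ, List.prod_cons, Fin.val_succ]
    rw [h]
    exact mul_inv_cancel _
  · change rot (⁅a, b⁆ * ⁅a, b⁆)⁻¹ ≠ 0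
    rw [rot_inv]
    exact neg_ne_zero.2 hrot


/-! ### Angular sectors of the disc -/

section Sector

open Complex

theorem cos_lt_cos_iff_exists_int {β θ : ℝ} (h0 : 0 ≤ β) (hπ : β ≤ Real.pi) :
    Real.cos β < Real.cos θ ↔ ∃ m : ℤ, |θ - m * (2 * Real.pi)| < β := by
  have key : ∀ m : ℤ, |θ - m * (2 * Real.pi)| ≤ Real.pi →
      (Real.cos β < Real.cos θ ↔ |θ - m * (2 * Real.pi)| < β) := by
    intro m hm
    rw [← Real.cos_sub_int_mul_two_pi θ m, ← Real.cos_abs (θ - m * (2 * Real.pi))]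
    exact Real.strictAntiOn_cos.lt_iff_gt ⟨h0, hπ⟩ ⟨abs_nonneg _, hm⟩
  constructor
  · intro h
    refine ⟨round (θ / (2 * Real.pi)), (key _ ?_).1 h⟩
    have h1 := abs_sub_round (θ / (2 * Real.pi))
    have h2 : θ - round (θ / (2 * Real.pi)) * (2 * Real.pi) =
        (θ / (2 * Real.pi) - round (θ / (2 * Real.pi))) * (2 * Real.pi) := by
      field_simp
    rw [h2, abs_mul, abs_of_pos Real.two_pi_pos]
    nlinarith [Real.pi_pos]
  · rintro ⟨m, hm⟩
    exact (key m (hm.le.trans hπ)).2 hm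

/-- The point `ρ exp (2πi x / 4ℓ)`, so that the `k`-th vertex of the polygon has angle `k`. -/
def polar (ℓ : ℕ) (ρ x : ℝ) : ℂ := ρ * exp (((2 * Real.pi * (x / (4 * ℓ)) : ℝ) : ℂ) * I)

/-- The open sector of the disc of angles at distance less than `r` from `x`, in units where the
full turn is `4ℓ`. -/
def sector (ℓ : ℕ) (x r : ℝ) : Set Disc :=
  {z | ‖(z : ℂ)‖ * Real.cos (2 * Real.pi * (r / (4 * ℓ))) < ((z : ℂ) * polar ℓ 1 (-x)).re}

theorem isOpen_sector (ℓ : ℕ) (x r : ℝ) : IsOpen (sector ℓ x r) :=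
  isOpen_lt (by fun_prop) (by fun_prop)

theorem polar_mul_polar (ℓ : ℕ) (ρ ρ' x y : ℝ) :
    polar ℓ ρ x * polar ℓ ρ' y = polar ℓ (ρ * ρ') (x + y) := by
  have h : (((2 * Real.pi * ((x + y) / (4 * ℓ)) : ℝ) : ℂ) * I) =
      ((2 * Real.pi * (x / (4 * ℓ)) : ℝ) : ℂ) * I + ((2 * Real.pi * (y / (4 * ℓ)) : ℝ) : ℂ) * I := by
    push_cast; ring
  simp only [polar, h, exp_add]
  push_cast
  ring

theorem polar_re (ℓ : ℕ) (ρ x : ℝ) :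
    (polar ℓ ρ x).re = ρ * Real.cos (2 * Real.pi * (x / (4 * ℓ))) := by
  rw [polar, re_ofReal_mul, exp_ofReal_mul_I_re]

theorem norm_polar (ℓ : ℕ) {ρ : ℝ} (hρ : 0 ≤ ρ) (x : ℝ) : ‖polar ℓ ρ x‖ = ρ := by
  rw [polar, norm_mul, norm_exp_ofReal_mul_I, mul_one, norm_real, Real.norm_of_nonneg hρ]

/-- The half-width is at most π, where cosine is decreasing, so the cosine inequality, which makes
openness evident, is a condition on angles modulo a full turn 4ℓ. -/
theorem mem_sector_iff {ℓ : ℕ} (hℓ : 0 < ℓ) {x r ρ y : ℝ} (hr0 : 0 ≤ r) (hr1 : r ≤ 1)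
    (hρ : 0 < ρ) {z : Disc} (hz : (z : ℂ) = polar ℓ ρ y) :
    z ∈ sector ℓ x r ↔ ∃ m : ℤ, |y - x - 4 * ℓ * m| < r := by
  have hℓ' : (1 : ℝ) ≤ ℓ := by exact_mod_cast hℓ
  have hr : 2 * Real.pi * (r / (4 * ℓ)) ≤ Real.pi := by
    rw [mul_div_assoc', div_le_iff₀ (by positivity)]
    nlinarith [Real.pi_pos]
  rw [sector, Set.mem_ofPred_eq, hz, polar_mul_polar, polar_re, norm_polar ℓ hρ.le, mul_one,
    mul_lt_mul_iff_right₀ hρ, cos_lt_cos_iff_exists_int (by positivity) hr]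
  refine exists_congr fun m => ?_
  have h : 2 * Real.pi * ((y + -x) / (4 * ℓ)) - m * (2 * Real.pi) =
      (2 * Real.pi / (4 * ℓ)) * (y - x - 4 * ℓ * m) := by
    field_simp
    ring
  rw [h, abs_mul, abs_of_pos (by positivity : (0 : ℝ) < 2 * Real.pi / (4 * ℓ)),
    show 2 * Real.pi * (r / (4 * ℓ)) = (2 * Real.pi / (4 * ℓ)) * r by ring,
    mul_lt_mul_iff_right₀ (by positivity)]

theorem coe_arc (ℓ k : ℕ) (t : ℝ) : (arc ℓ k t : ℂ) = polar ℓ 1 (k + t) := by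
  simp [arc, polar]

theorem exists_polar {ℓ : ℕ} (hℓ : 0 < ℓ) (z : ℂ) :
    ∃ y : ℝ, 0 ≤ y ∧ y < 4 * ℓ ∧ z = polar ℓ ‖z‖ y := by
  have hℓ' : (0 : ℝ) < 4 * ℓ := by positivity
  refine ⟨4 * ℓ * Int.fract (arg z / (2 * Real.pi)), by positivity, ?_, ?_⟩
  · exact mul_lt_of_lt_one_right hℓ' (Int.fract_lt_one _)
  · rw [polar, mul_div_cancel_left₀ _ hℓ'.ne', Int.fract]
    have h : (((2 * Real.pi * (arg z / (2 * Real.pi) - ⌊arg z / (2 * Real.pi)⌋) : ℝ) : ℂ) * I) =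
        arg z * I - (⌊arg z / (2 * Real.pi)⌋ : ℤ) * (2 * Real.pi * I) := by
      have : (Real.pi : ℂ) ≠ 0 := ofReal_ne_zero.2 Real.pi_ne_zero
      push_cast
      field_simp
    rw [h, exp_sub, exp_int_mul_two_pi_mul_I, div_one, norm_mul_exp_arg_mul_I]

theorem ne_zero_of_mem_sector {ℓ : ℕ} {x r : ℝ} {z : Disc} (h : z ∈ sector ℓ x r) :
    (z : ℂ) ≠ 0 := fun h0 => by
  simp [sector, h0] at h

end Sector

/-! ### The covering of the surface defined by a boundary word -/

section Cover

variable {Q : Type*} [Group Q] {ℓ : ℕ} {w : ℕ → Q}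

/-- `w k` is the value in `Q` of the initial segment of length `k` of the boundary word of the
polygon, for some assignment of elements of `Q` to the sides. -/
structure IsBoundaryWord (ℓ : ℕ) (w : ℕ → Q) : Prop where
  zero : w 0 = 1
  last : w (4 * ℓ) = 1
  side_a : ∀ i < ℓ, (w (4 * i))⁻¹ * w (4 * i + 1) = (w (4 * i + 3))⁻¹ * w (4 * i + 2)
  side_b : ∀ i < ℓ, (w (4 * i + 1))⁻¹ * w (4 * i + 2) = (w (4 * i + 4))⁻¹ * w (4 * i + 3)

/-- The side pairing of the copies of the polygon indexed by `Q`. -/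
inductive LiftPairing (ℓ : ℕ) (w : ℕ → Q) : Disc × Q → Disc × Q → Prop
  | a (i : Fin ℓ) (t : unitInterval) (q q' : Q) (h : q * w (4 * i) = q' * w (4 * i + 3)) :
      LiftPairing ℓ w (arc ℓ (4 * i) t, q) (arc ℓ (4 * i + 2) (1 - t), q')
  | b (i : Fin ℓ) (t : unitInterval) (q q' : Q) (h : q * w (4 * i + 1) = q' * w (4 * i + 4)) :
      LiftPairing ℓ w (arc ℓ (4 * i + 1) t, q) (arc ℓ (4 * i + 3) (1 - t), q')

theorem LiftPairing.smul {p p' : Disc × Q} (h : LiftPairing ℓ w p p') (g : Q) :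
    LiftPairing ℓ w (p.1, g * p.2) (p'.1, g * p'.2) := by
  cases h with
  | a i t q q' h => exact .a i t _ _ (by simp [mul_assoc, h])
  | b i t q q' h => exact .b i t _ _ (by simp [mul_assoc, h])

/-- The space obtained by gluing copies of the polygon indexed by `Q`. -/
def Cover (ℓ : ℕ) (w : ℕ → Q) : Type _ := Quot (LiftPairing ℓ w)

namespace Cover

/-- The point of the covering given by a point in a copy of the polygon. -/
def mk (ℓ : ℕ) (w : ℕ → Q) (p : Disc × Q) : Cover ℓ w := Quot.mk _ p

/-- The projection of the covering to the surface. -/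
def proj (e : Cover ℓ w) : Surface ℓ :=
  Quot.lift (fun p : Disc × Q => toSurface ℓ p.1) (by
    rintro _ _ (⟨i, t, q, q', h⟩ | ⟨i, t, q, q', h⟩)
    exacts [toSurface_a ℓ i t, toSurface_b ℓ i t]) e

instance : MulAction Q (Cover ℓ w) where
  smul g := Quot.map (fun p => (p.1, g * p.2)) fun _ _ h => h.smul g
  one_smul e := by
    induction e using Quot.ind with
    | mk p => exact congrArg (mk ℓ w) (Prod.ext rfl (one_mul p.2))
  mul_smul g h e := by
    induction e using Quot.ind with
    | mk p => exact congrArg (mk ℓ w) (Prod.ext rfl (mul_assoc g h p.2))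

theorem smul_mk (g : Q) (p : Disc × Q) : g • mk ℓ w p = mk ℓ w (p.1, g * p.2) := rfl

theorem mk_surjective : Function.Surjective (mk ℓ w) := Quot.mk_surjective

theorem exists_mk_eq_of_toSurface_eq {z z' : Disc} (h : toSurface ℓ z = toSurface ℓ z') (q : Q) :
    ∃ q' : Q, mk ℓ w (z, q) = mk ℓ w (z', q') := by
  replace h := Quot.eqvGen_exact h
  induction h generalizing q with
  | rel _ _ h =>
    cases h with
    | a i t => exact ⟨q * w (4 * i) * (w (4 * i + 3))⁻¹, Quot.sound (.a i t _ _ (by simp))⟩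
    | b i t => exact ⟨q * w (4 * i + 1) * (w (4 * i + 4))⁻¹, Quot.sound (.b i t _ _ (by simp))⟩
  | refl _ => exact ⟨q, rfl⟩
  -- The reversed identification ends in an uncontrolled sheet; a translation by Q moves it to the
  -- required one.
  | symm x y h ih =>
    obtain ⟨q', hq'⟩ := ih 1
    refine ⟨q * q'⁻¹, ?_⟩
    have := congrArg (fun e => (q * q'⁻¹) • e) hq'
    simp only [smul_mk, mul_one, inv_mul_cancel_right] at this
    exact this.symm
  | trans x y z _ _ ih1 ih2 =>
    obtain ⟨q', h1⟩ := ih1 q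
    obtain ⟨q'', h2⟩ := ih2 q'
    exact ⟨q'', h1.trans h2⟩

theorem proj_eq_iff {e e' : Cover ℓ w} : proj e = proj e' ↔ e ∈ MulAction.orbit Q e' := by
  obtain ⟨⟨z, q⟩, rfl⟩ := mk_surjective e
  obtain ⟨⟨z', q'⟩, rfl⟩ := mk_surjective e'
  constructor
  · intro h
    obtain ⟨q'', h⟩ := exists_mk_eq_of_toSurface_eq (w := w) h q
    exact ⟨q'' * q'⁻¹, by simp [smul_mk, h]⟩
  · rintro ⟨g, h⟩
    rw [← h]
    rfl

variable [TopologicalSpace Q]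

instance : TopologicalSpace (Cover ℓ w) :=
  inferInstanceAs (TopologicalSpace (Quot (LiftPairing ℓ w)))

theorem continuous_mk : Continuous (mk ℓ w) := continuous_quot_mk

theorem isQuotientMap_mk : IsQuotientMap (mk ℓ w) := isQuotientMap_quot_mk

theorem continuous_proj : Continuous (proj (ℓ := ℓ) (w := w)) :=
  continuous_quot_lift _ ((continuous_toSurface ℓ).comp continuous_fst)

theorem isQuotientMap_proj : IsQuotientMap (proj (ℓ := ℓ) (w := w)) := by
  have h : IsQuotientMap (toSurface ℓ) := isQuotientMap_quot_mk
  have hc : Continuous fun z : Disc => mk ℓ w (z, 1) := continuous_mk.comp (by fun_prop)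
  exact IsQuotientMap.of_comp hc continuous_proj h

instance [DiscreteTopology Q] : ContinuousConstSMul Q (Cover ℓ w) where
  continuous_const_smul g :=
    isQuotientMap_mk.continuous_iff.2 (continuous_mk.comp
      (f := fun p : Disc × Q => (p.1, g * p.2))
      (continuous_fst.prodMk (continuous_of_discreteTopology.comp continuous_snd)))

/-- The labels q·v_j on the sets S_j are compatible with the gluing, so they define a locally
constant function near the point. The group multiplies labels on the left, so a level set meets its
g-translate only for g = 1. -/
theorem exists_nhds_disjoint [DiscreteTopology Q] {ι : Type*} (S : ι → Set Disc) (v : ι → Q)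
    (hS : ∀ k, IsOpen (S k)) (hv : ∀ z j k, z ∈ S j → z ∈ S k → v j = v k)
    (h1 : ∀ p p', LiftPairing ℓ w p p' → ∀ k, p.1 ∈ S k →
      ∃ j, p'.1 ∈ S j ∧ p.2 * v k = p'.2 * v j)
    (h2 : ∀ p p', LiftPairing ℓ w p p' → ∀ k, p'.1 ∈ S k →
      ∃ j, p.1 ∈ S j ∧ p.2 * v j = p'.2 * v k)
    {z : Disc} {k : ι} (hz : z ∈ S k) (q : Q) :
    ∃ U ∈ 𝓝 (mk ℓ w (z, q)), ∀ g : Q, ((g • ·) '' U ∩ U).Nonempty → g = 1 := by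
  let T (h : Q) (e : Cover ℓ w) : Prop :=
    Quot.lift (fun p : Disc × Q => ∃ j, p.1 ∈ S j ∧ p.2 * v j = h) (by
      intro p p' hp
      refine propext ⟨?_, ?_⟩
      · rintro ⟨j, hj, hh⟩
        obtain ⟨j', hj', h'⟩ := h1 p p' hp j hj
        exact ⟨j', hj', h'.symm.trans hh⟩
      · rintro ⟨j, hj, hh⟩
        obtain ⟨j', hj', h'⟩ := h2 p p' hp j hj
        exact ⟨j', hj', h'.trans hh⟩) e
  refine ⟨{e | T (q * v k) e}, ?_, ?_⟩
  · refine IsOpen.mem_nhds ?_ ⟨k, hz, rfl⟩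
    rw [← isQuotientMap_mk.isOpen_preimage]
    have : mk ℓ w ⁻¹' {e | T (q * v k) e} =
        ⋃ j, (S j ×ˢ {q' : Q | q' * v j = q * v k}) := by
      ext p
      rw [Set.mem_iUnion]
      rfl
    rw [this]
    exact isOpen_iUnion fun j => (hS j).prod (isOpen_discrete _)
  · rintro g ⟨_, ⟨e, he, rfl⟩, hge⟩
    obtain ⟨p, rfl⟩ := mk_surjective e
    obtain ⟨j, hj, hjq⟩ : ∃ j, p.1 ∈ S j ∧ p.2 * v j = q * v k := he
    obtain ⟨j', hj', hjq'⟩ : ∃ j, p.1 ∈ S j ∧ g * p.2 * v j = q * v k := hge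
    rw [hv _ _ _ hj' hj, mul_assoc, hjq] at hjq'
    simpa using hjq'

end Cover

end Cover

/-! ### Evenly covered neighbourhoods of interior, vertex and edge points -/

section CoverCharts

variable {Q : Type*} [Group Q] {ℓ : ℕ} {w : ℕ → Q}

/-- Indices in [0, 4ℓ] congruent modulo 4ℓ are equal or are the two ends, where the word has value
1: this is the surface relation. -/
theorem IsBoundaryWord.eq_of_eq_add (hw : IsBoundaryWord ℓ w) {u v : ℕ} {m : ℤ} (hu : u ≤ 4 * ℓ)
    (hv : v ≤ 4 * ℓ) (h : (u : ℤ) = v + 4 * ℓ * m) : w u = w v := by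
  rcases Nat.eq_zero_or_pos ℓ with rfl | hℓ
  · obtain rfl : u = v := by omega
    rfl
  have h1 : m ≤ 1 := by
    by_contra hm
    have : 4 * (ℓ : ℤ) * 2 ≤ 4 * ℓ * m := by gcongr; omega
    omega
  have h2 : -1 ≤ m := by
    by_contra hm
    have : 4 * (ℓ : ℤ) * m ≤ 4 * ℓ * (-2) := by gcongr; omega
    omega
  obtain rfl | rfl | rfl : m = -1 ∨ m = 0 ∨ m = 1 := by omega
  · obtain rfl : u = 0 := by omega
    obtain rfl : v = 4 * ℓ := by omega
    rw [hw.zero, hw.last]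
  · obtain rfl : u = v := by omega
    rfl
  · obtain rfl : v = 0 := by omega
    obtain rfl : u = 4 * ℓ := by omega
    rw [hw.zero, hw.last]

theorem arc_mem_sector_iff (hℓ : 0 < ℓ) {j : ℕ} {t x : ℝ} :
    arc ℓ j t ∈ sector ℓ x (1 / 2) ↔ ∃ m : ℤ, |(j + t) - x - 4 * ℓ * m| < 1 / 2 :=
  mem_sector_iff hℓ (by norm_num) (by norm_num) one_pos (coe_arc ℓ j t)

theorem exists_int_of_mem_sector (hℓ : 0 < ℓ) {z : Disc} {x y : ℝ}
    (hx : z ∈ sector ℓ x (1 / 2)) (hy : z ∈ sector ℓ y (1 / 2)) :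
    ∃ m : ℤ, |x - y - 4 * ℓ * m| < 1 := by
  obtain ⟨s, -, -, hs⟩ := exists_polar hℓ (z : ℂ)
  have h0 := norm_pos_iff.2 (ne_zero_of_mem_sector hx)
  rw [mem_sector_iff hℓ (by norm_num) (by norm_num) h0 hs] at hx hy
  obtain ⟨m, hm⟩ := hx
  obtain ⟨n, hn⟩ := hy
  refine ⟨n - m, ?_⟩
  rw [abs_lt] at hm hn ⊢
  push_cast
  constructor <;> linarith [hm.1, hm.2, hn.1, hn.2]

theorem eq_zero_of_abs_lt_one {d : ℤ} (h : |(d : ℝ)| < 1) : d = 0 := by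
  rw [← Int.cast_abs] at h
  have : |d| < 1 := by exact_mod_cast h
  simpa using this

/-- The open sector around the `k`-th vertex of the polygon. -/
def vertexSector (ℓ k : ℕ) : Set Disc := {z | k ≤ 4 * ℓ ∧ z ∈ sector ℓ k (1 / 2)}

/-- The open sector over the interior of the `k`-th side of the polygon. -/
def edgeSector (ℓ k : ℕ) : Set Disc := {z | k < 4 * ℓ ∧ z ∈ sector ℓ (k + 1 / 2) (1 / 2)}

theorem isOpen_vertexSector (ℓ k : ℕ) : IsOpen (vertexSector ℓ k) :=
  isOpen_const.and (isOpen_sector ℓ _ _)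

theorem isOpen_edgeSector (ℓ k : ℕ) : IsOpen (edgeSector ℓ k) :=
  isOpen_const.and (isOpen_sector ℓ _ _)

theorem IsBoundaryWord.eq_of_mem_vertexSector (hw : IsBoundaryWord ℓ w) (hℓ : 0 < ℓ) {z : Disc}
    {j k : ℕ} (hj : z ∈ vertexSector ℓ j) (hk : z ∈ vertexSector ℓ k) : w j = w k := by
  obtain ⟨m, hm⟩ := exists_int_of_mem_sector hℓ hj.2 hk.2
  have h := eq_zero_of_abs_lt_one (d := (j : ℤ) - k - 4 * ℓ * m) (by push_cast; exact hm)
  exact hw.eq_of_eq_add hj.1 hk.1 (m := m) (by linarith)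

theorem eq_of_eq_add_of_lt {u v : ℕ} {m : ℤ} (hu : u < 4 * ℓ)
    (hv : v < 4 * ℓ) (h : (u : ℤ) = v + 4 * ℓ * m) : u = v := by
  have h1 : m < 1 := by
    by_contra hm
    have : 4 * (ℓ : ℤ) * 1 ≤ 4 * ℓ * m := by gcongr; omega
    omega
  have h2 : -1 < m := by
    by_contra hm
    have : 4 * (ℓ : ℤ) * m ≤ 4 * ℓ * (-1) := by gcongr; omega
    omega
  obtain rfl : m = 0 := by omega
  omega

theorem eq_of_mem_edgeSector (hℓ : 0 < ℓ) {z : Disc} {j k : ℕ} (hj : z ∈ edgeSector ℓ j)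
    (hk : z ∈ edgeSector ℓ k) : j = k := by
  obtain ⟨m, hm⟩ := exists_int_of_mem_sector hℓ hj.2 hk.2
  have h := eq_zero_of_abs_lt_one (d := (j : ℤ) - k - 4 * ℓ * m) (by
    push_cast; convert hm using 2; ring)
  exact eq_of_eq_add_of_lt hj.1 hk.1 (m := m) (by linarith)

/-- Vertex sectors reach only to the midpoints of the sides, so a side point in one of them is
closer to the start or to the end of its side, and the label is that of this vertex. -/
theorem IsBoundaryWord.of_arc_mem_vertexSector (hw : IsBoundaryWord ℓ w) {j k : ℕ} {t : ℝ}
    (hj : j < 4 * ℓ) (ht0 : 0 ≤ t) (ht1 : t ≤ 1) (h : arc ℓ j t ∈ vertexSector ℓ k) :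
    (t < 1 / 2 ∧ w k = w j) ∨ (1 / 2 < t ∧ w k = w (j + 1)) := by
  obtain ⟨hk, h⟩ := h
  obtain ⟨m, hm⟩ := (arc_mem_sector_iff (by omega)).1 h
  rw [abs_lt] at hm
  set d : ℤ := j - k - 4 * ℓ * m with hd
  have hd' : (d : ℝ) = j - k - 4 * ℓ * m := by rw [hd]; push_cast; ring
  have h1 : (-2 : ℝ) < d := by linarith [hm.1]
  have h2 : (d : ℝ) < 1 := by linarith [hm.2]
  have h3 : -2 < d := by exact_mod_cast h1
  have h4 : d < 1 := by exact_mod_cast h2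
  obtain h0 | h0 : d = 0 ∨ d = -1 := by omega
  · left
    rw [h0] at hd hd'
    push_cast at hd'
    exact ⟨by linarith [hm.2], (hw.eq_of_eq_add hj.le hk (m := m) (by linarith)).symm⟩
  · right
    rw [h0] at hd hd'
    push_cast at hd'
    refine ⟨by linarith [hm.1], (hw.eq_of_eq_add (u := j + 1) hj hk (m := m) ?_).symm⟩
    push_cast
    linarith

theorem arc_mem_vertexSector_left {j : ℕ} {t : ℝ} (hj : j < 4 * ℓ) (ht0 : 0 ≤ t)
    (ht : t < 1 / 2) : arc ℓ j t ∈ vertexSector ℓ j := by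
  refine ⟨hj.le, (arc_mem_sector_iff (by omega)).2 ⟨0, ?_⟩⟩
  rw [abs_lt]
  push_cast
  constructor <;> linarith

theorem arc_mem_vertexSector_right {j : ℕ} {t : ℝ} (hj : j < 4 * ℓ) (ht : 1 / 2 < t)
    (ht1 : t ≤ 1) : arc ℓ j t ∈ vertexSector ℓ (j + 1) := by
  refine ⟨hj, (arc_mem_sector_iff (by omega)).2 ⟨0, ?_⟩⟩
  rw [abs_lt]
  push_cast
  constructor <;> linarith

theorem arc_mem_edgeSector_iff {j k : ℕ} {t : ℝ} (hj : j < 4 * ℓ) (ht0 : 0 ≤ t) (ht1 : t ≤ 1) :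
    arc ℓ j t ∈ edgeSector ℓ k ↔ k = j ∧ 0 < t ∧ t < 1 := by
  constructor
  · rintro ⟨hk, h⟩
    obtain ⟨m, hm⟩ := (arc_mem_sector_iff (by omega)).1 h
    rw [abs_lt] at hm
    set d : ℤ := j - k - 4 * ℓ * m with hd
    have hd' : (d : ℝ) = j - k - 4 * ℓ * m := by rw [hd]; push_cast; ring
    have h1 : (-1 : ℝ) < d := by linarith [hm.1]
    have h2 : (d : ℝ) < 1 := by linarith [hm.2]
    have h3 : -1 < d := by exact_mod_cast h1
    have h4 : d < 1 := by exact_mod_cast h2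
    have h0 : d = 0 := by omega
    rw [h0] at hd hd'
    push_cast at hd'
    exact ⟨(eq_of_eq_add_of_lt hj hk (m := m) (by linarith)).symm, by linarith [hm.1],
      by linarith [hm.2]⟩
  · rintro ⟨rfl, h0, h1⟩
    refine ⟨hj, (arc_mem_sector_iff (by omega)).2 ⟨0, ?_⟩⟩
    rw [abs_lt]
    push_cast
    constructor <;> linarith

theorem norm_arc (ℓ k : ℕ) (t : ℝ) : ‖(arc ℓ k t : ℂ)‖ = 1 :=
  Complex.norm_exp_ofReal_mul_I _

/-- The trivialization constant of the covering over the interior of the `k`-th side. -/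
def edgeLabel (w : ℕ → Q) (k : ℕ) : Q := if k % 4 ≤ 1 then w k else w (k + 1)

theorem exists_sector_of_norm_eq_one (hℓ : 0 < ℓ) {z : Disc} (hz : ‖(z : ℂ)‖ = 1) :
    (∃ k, z ∈ vertexSector ℓ k) ∨ ∃ k, z ∈ edgeSector ℓ k := by
  obtain ⟨y, h0, h1, hy⟩ := exists_polar hℓ (z : ℂ)
  rw [hz] at hy
  have hk1 := Nat.floor_le h0
  have hk2 := Nat.lt_floor_add_one y
  have hk3 : ⌊y⌋₊ < 4 * ℓ := by
    rw [Nat.floor_lt h0]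
    exact_mod_cast h1
  rcases hk1.eq_or_lt with h | h
  · refine Or.inl ⟨⌊y⌋₊, hk3.le,
      (mem_sector_iff hℓ (by norm_num) (by norm_num) one_pos hy).2 ⟨0, ?_⟩⟩
    rw [h]
    simp
  · refine Or.inr ⟨⌊y⌋₊, hk3, (mem_sector_iff hℓ (by norm_num) (by norm_num) one_pos hy).2 ⟨0, ?_⟩⟩
    rw [abs_lt]
    push_cast
    constructor <;> linarith

namespace Cover

variable [TopologicalSpace Q] [DiscreteTopology Q]

theorem exists_nhds_disjoint_of_isBoundaryWord (hw : IsBoundaryWord ℓ w) (hℓ : 0 < ℓ)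
    (e : Cover ℓ w) : ∃ U ∈ 𝓝 e, ∀ g : Q, ((g • ·) '' U ∩ U).Nonempty → g = 1 := by
  obtain ⟨⟨z, q⟩, rfl⟩ := mk_surjective e
  have hza := hw.side_a
  have hzb := hw.side_b
  have hnorm : ‖(z : ℂ)‖ ≤ 1 := mem_closedBall_zero_iff.1 z.2
  rcases hnorm.lt_or_eq with hlt | heq
  · refine exists_nhds_disjoint (fun _ : Unit => {z : Disc | ‖(z : ℂ)‖ < 1}) (fun _ => 1)
      (fun _ => isOpen_lt (by fun_prop) (by fun_prop)) (fun _ _ _ _ _ => rfl) ?_ ?_ (k := ()) hlt q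
    · rintro _ _ (⟨i, t, q, q', h⟩ | ⟨i, t, q, q', h⟩) _ hk <;>
        exact absurd hk (by simp [norm_arc])
    · rintro _ _ (⟨i, t, q, q', h⟩ | ⟨i, t, q, q', h⟩) _ hk <;>
        exact absurd hk (by simp [norm_arc])
  rcases exists_sector_of_norm_eq_one hℓ heq with ⟨k, hk⟩ | ⟨k, hk⟩
  · refine exists_nhds_disjoint (vertexSector ℓ) w (isOpen_vertexSector ℓ)
      (fun _ _ _ => hw.eq_of_mem_vertexSector hℓ) ?_ ?_ hk q
    · rintro _ _ (⟨i, t, q, q', h⟩ | ⟨i, t, q, q', h⟩) k hk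
      · have hi := i.2
        have ha := hza i hi
        rcases hw.of_arc_mem_vertexSector (by omega) t.2.1 t.2.2 hk with ⟨ht, hk⟩ | ⟨ht, hk⟩
        · refine ⟨_, arc_mem_vertexSector_right (by omega) (by linarith) (by linarith [t.2.1]), ?_⟩
          simpa only [hk] using h
        · refine ⟨_, arc_mem_vertexSector_left (by omega) (by linarith [t.2.2]) (by linarith), ?_⟩
          simp only [hk]
          -- The gluing condition matches the labels at one end of the side; `side_a` transports it
          -- to the other end.
          rw [inv_mul_eq_iff_eq_mul] at ha
          rw [ha, ← mul_assoc, h]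
          group
      · have hi := i.2
        have hb := hzb i hi
        rcases hw.of_arc_mem_vertexSector (by omega) t.2.1 t.2.2 hk with ⟨ht, hk⟩ | ⟨ht, hk⟩
        · refine ⟨_, arc_mem_vertexSector_right (by omega) (by linarith) (by linarith [t.2.1]), ?_⟩
          simpa only [hk] using h
        · refine ⟨_, arc_mem_vertexSector_left (by omega) (by linarith [t.2.2]) (by linarith), ?_⟩
          simp only [hk]
          rw [inv_mul_eq_iff_eq_mul] at hb
          rw [hb, ← mul_assoc, h]
          group
    · rintro _ _ (⟨i, t, q, q', h⟩ | ⟨i, t, q, q', h⟩) k hk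
      · have hi := i.2
        have ha := hza i hi
        rcases hw.of_arc_mem_vertexSector (by omega) (by linarith [t.2.2]) (by linarith [t.2.1]) hk
          with ⟨ht, hk⟩ | ⟨ht, hk⟩
        · refine ⟨_, arc_mem_vertexSector_right (by omega) (by linarith) t.2.2, ?_⟩
          simp only [hk]
          rw [inv_mul_eq_iff_eq_mul] at ha
          rw [ha, ← mul_assoc, h]
          group
        · refine ⟨_, arc_mem_vertexSector_left (by omega) t.2.1 (by linarith), ?_⟩
          simpa only [hk] using h
      · have hi := i.2
        have hb := hzb i hi
        rcases hw.of_arc_mem_vertexSector (by omega) (by linarith [t.2.2]) (by linarith [t.2.1]) hk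
          with ⟨ht, hk⟩ | ⟨ht, hk⟩
        · refine ⟨_, arc_mem_vertexSector_right (by omega) (by linarith) t.2.2, ?_⟩
          simp only [hk]
          rw [inv_mul_eq_iff_eq_mul] at hb
          rw [hb, ← mul_assoc, h]
          group
        · refine ⟨_, arc_mem_vertexSector_left (by omega) t.2.1 (by linarith), ?_⟩
          simpa only [hk] using h
  -- The edge labels are chosen so that the gluing condition itself is their equality across the
  -- side.
  · refine exists_nhds_disjoint (edgeSector ℓ) (edgeLabel w) (isOpen_edgeSector ℓ)
      (fun _ _ _ hj hk => by rw [eq_of_mem_edgeSector hℓ hj hk]) ?_ ?_ hk q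
    · rintro _ _ (⟨i, t, q, q', h⟩ | ⟨i, t, q, q', h⟩) k hk
      · have hi := i.2
        obtain ⟨rfl, h0, h1⟩ := (arc_mem_edgeSector_iff (by omega) t.2.1 t.2.2).1 hk
        refine ⟨_, (arc_mem_edgeSector_iff (by omega) (by linarith) (by linarith)).2
          ⟨rfl, by linarith, by linarith⟩, ?_⟩
        simpa [edgeLabel, Nat.add_mod] using h
      · have hi := i.2
        obtain ⟨rfl, h0, h1⟩ := (arc_mem_edgeSector_iff (by omega) t.2.1 t.2.2).1 hk
        refine ⟨_, (arc_mem_edgeSector_iff (by omega) (by linarith) (by linarith)).2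
          ⟨rfl, by linarith, by linarith⟩, ?_⟩
        simpa [edgeLabel, Nat.add_mod] using h
    · rintro _ _ (⟨i, t, q, q', h⟩ | ⟨i, t, q, q', h⟩) k hk
      · have hi := i.2
        obtain ⟨rfl, h0, h1⟩ := (arc_mem_edgeSector_iff (by omega) (by linarith [t.2.2])
          (by linarith [t.2.1])).1 hk
        refine ⟨_, (arc_mem_edgeSector_iff (by omega) t.2.1 t.2.2).2
          ⟨rfl, by linarith, by linarith⟩, ?_⟩
        simpa [edgeLabel, Nat.add_mod] using h
      · have hi := i.2
        obtain ⟨rfl, h0, h1⟩ := (arc_mem_edgeSector_iff (by omega) (by linarith [t.2.2])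
          (by linarith [t.2.1])).1 hk
        refine ⟨_, (arc_mem_edgeSector_iff (by omega) t.2.1 t.2.2).2
          ⟨rfl, by linarith, by linarith⟩, ?_⟩
        simpa [edgeLabel, Nat.add_mod] using h

theorem isQuotientCoveringMap_proj (hw : IsBoundaryWord ℓ w) (hℓ : 0 < ℓ) :
    IsQuotientCoveringMap (proj (ℓ := ℓ) (w := w)) Q where
  toIsQuotientMap := isQuotientMap_proj
  toContinuousConstSMul := inferInstance
  apply_eq_iff_mem_orbit := proj_eq_iff
  disjoint := exists_nhds_disjoint_of_isBoundaryWord hw hℓ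

end Cover

end CoverCharts

/-! ### Homomorphisms from the fundamental group of the surface -/

section Monodromy

variable {Q : Type*} [Group Q] {ℓ : ℕ} {w : ℕ → Q}

namespace Cover

/-- The lifted corner at vertex k of sheet q is governed by q·w(k); corners with the same value h
are glued together. -/
theorem mk_corners (hw : IsBoundaryWord ℓ w) (i : Fin ℓ) (h : Q) :
    mk ℓ w (arc ℓ (4 * i + 3) 0, h * (w (4 * i + 3))⁻¹) =
      mk ℓ w (arc ℓ (4 * i) 0, h * (w (4 * i))⁻¹) ∧
    mk ℓ w (arc ℓ (4 * i + 2) 0, h * (w (4 * i + 2))⁻¹) =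
      mk ℓ w (arc ℓ (4 * i) 0, h * (w (4 * i))⁻¹) ∧
    mk ℓ w (arc ℓ (4 * i + 1) 0, h * (w (4 * i + 1))⁻¹) =
      mk ℓ w (arc ℓ (4 * i) 0, h * (w (4 * i))⁻¹) ∧
    mk ℓ w (arc ℓ (4 * i + 4) 0, h * (w (4 * i + 4))⁻¹) =
      mk ℓ w (arc ℓ (4 * i) 0, h * (w (4 * i))⁻¹) := by
  have ha := hw.side_a i i.2
  have hb := hw.side_b i i.2
  have a0 := Quot.sound (LiftPairing.a (w := w) i 0 (h * (w (4 * i))⁻¹)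
    (h * (w (4 * i + 3))⁻¹) (by simp))
  have a1 := Quot.sound (LiftPairing.a (w := w) i 1 (h * (w (4 * i + 1))⁻¹)
    (h * (w (4 * i + 2))⁻¹) (by
      have := congrArg (fun x => h * x⁻¹) ha
      simpa [mul_assoc] using this))
  have b0 := Quot.sound (LiftPairing.b (w := w) i 0 (h * (w (4 * i + 1))⁻¹)
    (h * (w (4 * i + 4))⁻¹) (by simp))
  have b1 := Quot.sound (LiftPairing.b (w := w) i 1 (h * (w (4 * i + 2))⁻¹)
    (h * (w (4 * i + 3))⁻¹) (by
      have := congrArg (fun x => h * x⁻¹) hb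
      simpa [mul_assoc] using this))
  simp only [Set.Icc.coe_zero, Set.Icc.coe_one, sub_zero, sub_self, arc_one, add_assoc,
    Nat.reduceAdd] at a0 a1 b0 b1
  exact ⟨a0.symm, b1.trans a0.symm, a1.trans (b1.trans a0.symm),
    b0.symm.trans (a1.trans (b1.trans a0.symm))⟩

theorem mk_arc_four_mul (hw : IsBoundaryWord ℓ w) {i : ℕ} (hi : i ≤ ℓ) (h : Q) :
    mk ℓ w (arc ℓ (4 * i) 0, h * (w (4 * i))⁻¹) = mk ℓ w (arc ℓ 0 0, h) := by
  induction i with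
  | zero => simp [hw.zero]
  | succ i ih =>
    rw [← ih (by omega)]
    exact (mk_corners hw ⟨i, hi⟩ h).2.2.2

end Cover

/-- A boundary word in `Q` defines a homomorphism from the fundamental group of the surface. -/
theorem IsBoundaryWord.exists_hom (hw : IsBoundaryWord ℓ w) (hℓ : 0 < ℓ) :
    ∃ φ : FundamentalGroup (Surface ℓ) (vertex ℓ) →* Q, ∀ i : Fin ℓ,
      φ (genA ℓ i) = (w (4 * i))⁻¹ * w (4 * i + 1) ∧
      φ (genB ℓ i) = (w (4 * i + 1))⁻¹ * w (4 * i + 2) := by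
  let _ : TopologicalSpace Q := ⊥
  have : DiscreteTopology Q := ⟨rfl⟩
  have hp := Cover.isQuotientCoveringMap_proj hw hℓ
  let e : Cover.proj (ℓ := ℓ) (w := w) ⁻¹' {vertex ℓ} := ⟨Cover.mk ℓ w (arc ℓ 0 0, 1), rfl⟩
  -- The monodromy takes values in the opposite group, so it is composed with inversion; the
  -- inverses in `genA` and `genB` undo this on generators.
  let φ : FundamentalGroup (Surface ℓ) (vertex ℓ) →* Q :=
    (MulEquiv.inv' Q).symm.toMonoidHom.comp (hp.fundamentalGroupToMulOpposite e)
  have key : ∀ (γ : Path (vertex ℓ) (vertex ℓ)) (k : ℕ) (u v : Q),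
      (∀ t : unitInterval, γ t = toSurface ℓ (arc ℓ k t)) →
      Cover.mk ℓ w (arc ℓ k 0, 1 * u⁻¹) = Cover.mk ℓ w (arc ℓ 0 0, 1) →
      Cover.mk ℓ w (arc ℓ (k + 1) 0, u⁻¹ * v * v⁻¹) = Cover.mk ℓ w (arc ℓ 0 0, u⁻¹ * v) →
      φ (FundamentalGroup.fromPath (Path.Homotopic.Quotient.mk γ))⁻¹ = u⁻¹ * v := by
    intro γ k u v hγ h0 h1
    have hop : hp.fundamentalGroupToMulOpposite e
        (FundamentalGroup.fromPath (Path.Homotopic.Quotient.mk γ)) = MulOpposite.op (u⁻¹ * v) := by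
      rw [hp.fundamentalGroupToMulOpposite_apply_eq_Iff]
      -- The lift of the k-th side is that side within the single sheet u⁻¹.
      let Γ : C(unitInterval, Cover ℓ w) :=
        ⟨fun t => Cover.mk ℓ w (arc ℓ k t, u⁻¹), Cover.continuous_mk.comp
          (((continuous_arc ℓ k).comp continuous_subtype_val).prodMk continuous_const)⟩
      have hΓ0 : Γ 0 = e := by
        change Cover.mk ℓ w (arc ℓ k 0, u⁻¹) = _
        rw [one_mul] at h0
        exact h0
      have hlift : Γ = hp.isCoveringMap.liftPath γ e (γ.source.trans e.2.symm) := by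
        rw [hp.isCoveringMap.eq_liftPath_iff']
        exact ⟨funext fun t => (hγ t).symm, hΓ0⟩
      change _ = hp.isCoveringMap.liftPath γ e (γ.source.trans e.2.symm) 1
      rw [← hlift]
      change Cover.mk ℓ w (arc ℓ 0 0, u⁻¹ * v * 1) = Cover.mk ℓ w (arc ℓ k 1, u⁻¹)
      rw [mul_one, ← h1, arc_one, mul_inv_cancel_right]
    rw [map_inv]
    change ((MulEquiv.inv' Q).symm (hp.fundamentalGroupToMulOpposite e _))⁻¹ = _
    rw [hop]
    simp
  refine ⟨φ, fun i => ⟨?_, ?_⟩⟩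
  · refine key (edgeA ℓ i) (4 * i) _ _ (fun t => rfl) (Cover.mk_arc_four_mul hw i.2.le 1) ?_
    rw [(Cover.mk_corners hw i _).2.2.1, Cover.mk_arc_four_mul hw i.2.le]
  · refine key (edgeB ℓ i) (4 * i + 1) _ _ (fun t => rfl) ?_ ?_
    · rw [(Cover.mk_corners hw i _).2.2.1, Cover.mk_arc_four_mul hw i.2.le]
    · rw [(Cover.mk_corners hw i _).2.1, Cover.mk_arc_four_mul hw i.2.le]

/-- The value of the initial segment of length `k` of the boundary word. -/
def boundaryWord (A B : Fin ℓ → Q) (k : ℕ) : Q :=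
  ((List.ofFn fun i => ⁅A i, B i⁆).take (k / 4)).prod *
    if h : k / 4 < ℓ then
      match k % 4 with
      | 0 => 1
      | 1 => A ⟨k / 4, h⟩
      | 2 => A ⟨k / 4, h⟩ * B ⟨k / 4, h⟩
      | _ => A ⟨k / 4, h⟩ * B ⟨k / 4, h⟩ * (A ⟨k / 4, h⟩)⁻¹
    else 1

theorem boundaryWord_four_mul (A B : Fin ℓ → Q) (i : ℕ) :
    boundaryWord A B (4 * i) = ((List.ofFn fun i => ⁅A i, B i⁆).take i).prod := by
  simp [boundaryWord]

theorem boundaryWord_four_mul_add_one (A B : Fin ℓ → Q) (i : Fin ℓ) :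
    boundaryWord A B (4 * i + 1) = boundaryWord A B (4 * i) * A i := by
  rw [boundaryWord_four_mul, boundaryWord]
  simp [show (4 * (i : ℕ) + 1) / 4 = i by omega, show (4 * (i : ℕ) + 1) % 4 = 1 by omega]

theorem boundaryWord_four_mul_add_two (A B : Fin ℓ → Q) (i : Fin ℓ) :
    boundaryWord A B (4 * i + 2) = boundaryWord A B (4 * i) * (A i * B i) := by
  rw [boundaryWord_four_mul, boundaryWord]
  simp [show (4 * (i : ℕ) + 2) / 4 = i by omega, show (4 * (i : ℕ) + 2) % 4 = 2 by omega]

theorem boundaryWord_four_mul_add_three (A B : Fin ℓ → Q) (i : Fin ℓ) :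
    boundaryWord A B (4 * i + 3) = boundaryWord A B (4 * i) * (A i * B i * (A i)⁻¹) := by
  rw [boundaryWord_four_mul, boundaryWord]
  simp [show (4 * (i : ℕ) + 3) / 4 = i by omega, show (4 * (i : ℕ) + 3) % 4 = 3 by omega]

theorem prod_take_ofFn_succ (f : Fin ℓ → Q) (i : Fin ℓ) :
    ((List.ofFn f).take (i + 1)).prod = ((List.ofFn f).take i).prod * f i := by
  rw [List.prod_take_succ _ _ (by simp)]
  simp

theorem boundaryWord_four_mul_add_four (A B : Fin ℓ → Q) (i : Fin ℓ) :
    boundaryWord A B (4 * i + 4) = boundaryWord A B (4 * i) * ⁅A i, B i⁆ := by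
  rw [show 4 * (i : ℕ) + 4 = 4 * (i + 1) by ring, boundaryWord_four_mul, boundaryWord_four_mul,
    prod_take_ofFn_succ (fun i => ⁅A i, B i⁆)]

theorem isBoundaryWord_boundaryWord (A B : Fin ℓ → Q)
    (h : (List.ofFn fun i => ⁅A i, B i⁆).prod = 1) : IsBoundaryWord ℓ (boundaryWord A B) where
  zero := boundaryWord_four_mul A B 0
  last := by
    rw [boundaryWord_four_mul, List.take_of_length_le (by simp), h]
  side_a i hi := by
    have h1 := boundaryWord_four_mul_add_one A B ⟨i, hi⟩
    have h2 := boundaryWord_four_mul_add_two A B ⟨i, hi⟩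
    have h3 := boundaryWord_four_mul_add_three A B ⟨i, hi⟩
    simp only at h1 h2 h3
    rw [h1, h2, h3]
    group
  side_b i hi := by
    have h1 := boundaryWord_four_mul_add_one A B ⟨i, hi⟩
    have h2 := boundaryWord_four_mul_add_two A B ⟨i, hi⟩
    have h3 := boundaryWord_four_mul_add_three A B ⟨i, hi⟩
    have h4 := boundaryWord_four_mul_add_four A B ⟨i, hi⟩
    simp only at h1 h2 h3 h4
    rw [h1, h2, h3, h4, commutatorElement_def]
    group

/-- Elements satisfying the surface relation are the images of the standard generators under a
homomorphism from the fundamental group of the surface. -/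
theorem exists_hom_of_prod_commutator_eq_one (hℓ : 0 < ℓ) (A B : Fin ℓ → Q)
    (h : (List.ofFn fun i => ⁅A i, B i⁆).prod = 1) :
    ∃ φ : FundamentalGroup (Surface ℓ) (vertex ℓ) →* Q,
      (∀ i, φ (genA ℓ i) = A i) ∧ ∀ i, φ (genB ℓ i) = B i := by
  obtain ⟨φ, hφ⟩ := (isBoundaryWord_boundaryWord A B h).exists_hom hℓ
  refine ⟨φ, fun i => ?_, fun i => ?_⟩
  · rw [(hφ i).1, boundaryWord_four_mul_add_one]
    group
  · rw [(hφ i).2, boundaryWord_four_mul_add_one, boundaryWord_four_mul_add_two]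
    group

end Monodromy

/-! ### The relation between the standard generators -/

section Relation

variable {ℓ : ℕ}

instance : ContractibleSpace Disc :=
  (convex_closedBall (0 : ℂ) 1).contractibleSpace ⟨0, by simp⟩

/-- `g⁻¹` is the class of a loop in the surface that lifts to a path from `z` to `z'` in the disc;
the inverse makes the multiplication agree with concatenation of paths. -/
def IsDiscClass (g : FundamentalGroup (Surface ℓ) (vertex ℓ)) (z z' : Disc) : Prop :=
  ∃ (p : Path z z') (hz : vertex ℓ = toSurface ℓ z) (hz' : vertex ℓ = toSurface ℓ z'),
    g⁻¹ = FundamentalGroup.fromPath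
      (Path.Homotopic.Quotient.mk ((p.map (continuous_toSurface ℓ)).cast hz hz'))

namespace IsDiscClass

variable {g h : FundamentalGroup (Surface ℓ) (vertex ℓ)} {z z' z'' : Disc}

/-- Inversion reverses products, as does the convention for composing loops; the two reversals
cancel. -/
theorem mul (hg : IsDiscClass g z z') (hh : IsDiscClass h z' z'') :
    IsDiscClass (g * h) z z'' := by
  obtain ⟨p, hz, hz', hg⟩ := hg
  obtain ⟨q, _, hz'', hh⟩ := hh
  refine ⟨p.trans q, hz, hz'', ?_⟩
  rw [mul_inv_rev, hg, hh, FundamentalGroup.mul_def]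
  change Path.Homotopic.Quotient.trans (Path.Homotopic.Quotient.mk _)
    (Path.Homotopic.Quotient.mk _) = Path.Homotopic.Quotient.mk _
  rw [← Path.Homotopic.Quotient.mk_trans]
  congr 1
  rw [Path.map_trans]
  rfl

theorem inv (hg : IsDiscClass g z z') : IsDiscClass g⁻¹ z' z := by
  obtain ⟨p, hz, hz', hg⟩ := hg
  refine ⟨p.symm, hz', hz, ?_⟩
  rw [hg, FundamentalGroup.inv_def]
  change Path.Homotopic.Quotient.symm (Path.Homotopic.Quotient.mk _) = _
  rw [← Path.Homotopic.Quotient.mk_symm]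
  rfl

/-- The lifted loop contracts in the disc, and the contraction projects to the surface. -/
theorem eq_one (hg : IsDiscClass g z z) : g = 1 := by
  obtain ⟨p, hz, hz', hg⟩ := hg
  have hp : p.Homotopic (Path.refl z) := SimplyConnectedSpace.paths_homotopic p (Path.refl z)
  have h1 := ((hp.map ⟨toSurface ℓ, continuous_toSurface ℓ⟩).pathCast hz hz')
  rw [← inv_eq_one, hg, FundamentalGroup.one_def]
  refine (Path.Homotopic.Quotient.eq.2 h1).trans ?_
  rw [← Path.Homotopic.Quotient.mk_refl]
  congr 1
  ext t
  exact hz.symm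

end IsDiscClass

/-- The `k`-th side of the polygon as a path in the disc. -/
def arcPath (ℓ k : ℕ) : Path (arc ℓ k 0) (arc ℓ (k + 1) 0) where
  toFun t := arc ℓ k t
  continuous_toFun := (continuous_arc ℓ k).comp continuous_subtype_val
  source' := by simp
  target' := by simp [arc_one]

theorem isDiscClass_genA (i : Fin ℓ) :
    IsDiscClass (genA ℓ i) (arc ℓ (4 * i) 0) (arc ℓ (4 * i + 1) 0) := by
  have h0 := toSurface_arc_zero ℓ i i.2.le
  refine ⟨arcPath ℓ (4 * i), h0.symm, ((toSurface_corners ℓ i).2.2.1.trans h0).symm, ?_⟩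
  rw [genA, inv_inv]
  rfl

theorem isDiscClass_genB (i : Fin ℓ) :
    IsDiscClass (genB ℓ i) (arc ℓ (4 * i + 1) 0) (arc ℓ (4 * i + 2) 0) := by
  have h0 := toSurface_arc_zero ℓ i i.2.le
  refine ⟨arcPath ℓ (4 * i + 1), ((toSurface_corners ℓ i).2.2.1.trans h0).symm,
    ((toSurface_corners ℓ i).2.1.trans h0).symm, ?_⟩
  rw [genB, inv_inv]
  rfl

theorem isDiscClass_genA_inv (i : Fin ℓ) :
    IsDiscClass (genA ℓ i)⁻¹ (arc ℓ (4 * i + 2) 0) (arc ℓ (4 * i + 3) 0) := by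
  have h0 := toSurface_arc_zero ℓ i i.2.le
  refine IsDiscClass.inv ⟨(arcPath ℓ (4 * i + 2)).symm,
    ((toSurface_corners ℓ i).1.trans h0).symm, ((toSurface_corners ℓ i).2.1.trans h0).symm, ?_⟩
  rw [genA, inv_inv]
  congr 2
  ext t
  refine (toSurface_a ℓ i t).trans ?_
  simp [arcPath]

theorem isDiscClass_genB_inv (i : Fin ℓ) :
    IsDiscClass (genB ℓ i)⁻¹ (arc ℓ (4 * i + 3) 0) (arc ℓ (4 * i + 4) 0) := by
  have h0 := toSurface_arc_zero ℓ i i.2.le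
  refine IsDiscClass.inv ⟨(arcPath ℓ (4 * i + 3)).symm,
    ((toSurface_corners ℓ i).2.2.2.trans h0).symm, ((toSurface_corners ℓ i).1.trans h0).symm, ?_⟩
  rw [genB, inv_inv]
  congr 2
  ext t
  refine (toSurface_b ℓ i t).trans ?_
  simp [arcPath]

/-- Each commutator is read along four consecutive sides, so the full product lifts to the whole
boundary circle, a loop in the disc. -/
theorem isDiscClass_prod_take (hℓ : 0 < ℓ) {i : ℕ} (hi : i ≤ ℓ) :
    IsDiscClass ((List.ofFn fun i => ⁅genA ℓ i, genB ℓ i⁆).take i).prod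
      (arc ℓ 0 0) (arc ℓ (4 * i) 0) := by
  induction i with
  | zero =>
    -- The trivial class is obtained by going along the first side and back.
    have h := (isDiscClass_genA (⟨0, hℓ⟩ : Fin ℓ)).mul (isDiscClass_genA ⟨0, hℓ⟩).inv
    rw [mul_inv_cancel] at h
    exact h
  | succ i ih =>
    have h := prod_take_ofFn_succ (fun i => ⁅genA ℓ i, genB ℓ i⁆) ⟨i, hi⟩
    rw [h]
    refine (ih (by omega)).mul ?_
    exact (((isDiscClass_genA ⟨i, hi⟩).mul (isDiscClass_genB ⟨i, hi⟩)).mul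
      (isDiscClass_genA_inv ⟨i, hi⟩)).mul (isDiscClass_genB_inv ⟨i, hi⟩)

theorem arc_four_mul_self (hℓ : 0 < ℓ) : arc ℓ (4 * ℓ) 0 = arc ℓ 0 0 := by
  have : (ℓ : ℂ) ≠ 0 := by exact_mod_cast hℓ.ne'
  apply Subtype.ext
  simp [arc, this, Complex.exp_two_pi_mul_I]

/-- The surface relation. -/
theorem prod_commutator_gen (hℓ : 0 < ℓ) :
    (List.ofFn fun i => ⁅genA ℓ i, genB ℓ i⁆).prod = 1 := by
  have h := isDiscClass_prod_take hℓ le_rfl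
  rw [List.take_of_length_le (by simp), arc_four_mul_self hℓ] at h
  exact h.eq_one

theorem prod_commutator_map_gen (hℓ : 0 < ℓ) {H : Type*} [Group H]
    (F : FundamentalGroup (Surface ℓ) (vertex ℓ) →* H) :
    (List.ofFn fun i => ⁅F (genA ℓ i), F (genB ℓ i)⁆).prod = 1 := by
  have := congrArg F (prod_commutator_gen hℓ)
  rw [map_list_prod, List.map_ofFn, map_one] at this
  rw [← this]
  congr 2
  funext i
  exact (map_commutatorElement F _ _).symm

instance : PathConnectedSpace (Surface ℓ) :=
  (Quot.mk_surjective (r := SidePairing ℓ)).pathConnectedSpace (continuous_toSurface ℓ)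

end Relation

end

end SurfaceScl

/-- Let `X` be a closed connected oriented surface of genus `ℓ ≥ 2`, i.e. a space homeomorphic to
the standard surface of genus `ℓ`. For every base point, `scl_G` and `scl_{G,G'}` are not
equivalent on `[G, G']`, where `G` is the fundamental group of `X`; and the explicit sequence `x_n`
lies in `[G, G']`, has bounded `scl_G`, and has `scl_{G,G'}` tending to infinity. -/
theorem theorem1p1 (ℓ : ℕ) (hℓ : 2 ≤ ℓ) {X : Type*} [TopologicalSpace X]
    (e : SurfaceScl.Surface ℓ ≃ₜ X) :
    (∀ p : X, ¬ SurfaceScl.SclEquivalent (commutator (FundamentalGroup X p))) ∧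
    (∀ n : ℕ, SurfaceScl.surfaceWitness e n ∈
      ⁅(⊤ : Subgroup (FundamentalGroup X (e (SurfaceScl.vertex ℓ)))),
        commutator (FundamentalGroup X (e (SurfaceScl.vertex ℓ)))⁆) ∧
    BddAbove (Set.range fun n : ℕ => SurfaceScl.scl (SurfaceScl.surfaceWitness e n)) ∧
    Filter.Tendsto
      (fun n : ℕ => SurfaceScl.mixedScl
        (commutator (FundamentalGroup X (e (SurfaceScl.vertex ℓ))))
        (SurfaceScl.surfaceWitness e n))
      Filter.atTop Filter.atTop := by
  have hpos : 0 < ℓ := by omega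
  let F := FundamentalGroup.map (e : C(SurfaceScl.Surface ℓ, X)) (SurfaceScl.vertex ℓ)
  let A : Fin ℓ → FundamentalGroup X (e (SurfaceScl.vertex ℓ)) := fun i => F (SurfaceScl.genA ℓ i)
  let B : Fin ℓ → FundamentalGroup X (e (SurfaceScl.vertex ℓ)) := fun i => F (SurfaceScl.genB ℓ i)
  have hAB := SurfaceScl.prod_commutator_map_gen hpos F
  obtain ⟨a, b, c, habc, hc⟩ := SurfaceScl.exists_prod_commutator_central hℓ
  obtain ⟨φ, hφA, hφB⟩ := SurfaceScl.exists_hom_of_prod_commutator_eq_one hpos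
    (SurfaceScl.twistA c a) (SurfaceScl.twistB c b) (SurfaceScl.prod_commutator_twist hpos a b habc)
  let E : FundamentalGroup X (e (SurfaceScl.vertex ℓ)) →*
      FundamentalGroup (SurfaceScl.Surface ℓ) (SurfaceScl.vertex ℓ) :=
    FundamentalGroup.mapOfEq (e.symm : C(X, SurfaceScl.Surface ℓ)) (e.symm_apply_apply _)
  -- E inverts F on the left, so φ ∘ E takes the transported generators to the prescribed elements
  -- of the twisted product.
  have hEF : ∀ g, E (F g) = g := by
    intro g
    induction g using Path.Homotopic.Quotient.ind with
    | mk γ =>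
      refine (FundamentalGroup.mapOfEq_apply _ _ _).trans ?_
      refine congrArg Path.Homotopic.Quotient.mk ?_
      ext t
      exact e.symm_apply_apply (γ t)
  have hmem : ∀ n, SurfaceScl.surfaceWitness e n ∈ _ := SurfaceScl.witness_mem A B hAB
  have hscl : ∀ n, SurfaceScl.scl (SurfaceScl.surfaceWitness e n) ≤ ℓ :=
    SurfaceScl.scl_witness_le A B
  have hlim := SurfaceScl.tendsto_mixedScl_witness hpos a b hc A B hAB (φ.comp E)
    (fun i => by rw [MonoidHom.comp_apply, hEF, hφA]) fun i => by
      rw [MonoidHom.comp_apply, hEF, hφB]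
  refine ⟨fun p hp => ?_, hmem, ⟨ℓ, ?_⟩, hlim⟩
  · have : PathConnectedSpace X := e.surjective.pathConnectedSpace e.continuous
    -- A change of base point is an isomorphism, so an equivalence at p would give one at the image
    -- of the vertex, contradicting scl ≤ ℓ and the divergence.
    obtain ⟨C, hC, h⟩ := hp.congr
      (FundamentalGroup.fundamentalGroupMulEquivOfPathConnected (e (SurfaceScl.vertex ℓ)) p)
    obtain ⟨n, hn⟩ := (hlim.eventually_gt_atTop (C * ℓ)).exists
    have h1 := h _ (hmem n)
    have h2 := mul_le_mul_of_nonneg_left (hscl n) hC.le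
    exact absurd (hn.trans_le (h1.trans h2)) (lt_irrefl _)
  · rintro _ ⟨n, rfl⟩
    exact hscl n
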